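/- Let $G(s)$ be a stable real-rational system with $p$ inputs and $m$ outputs, i.e. an $m\times p$ matrix of proper real rational functions all of whose poles lie in the open left half-plane. Let $n$ be its number of poles counted with multiplicity, i.e. its McMillan degree: the smallest state dimension of a realization $G(s)=C(sI-A)^{-1}B+D$ with real matrices $A,B,C,D$. Let $$\|G\|_\infty=\sup_{\omega\in\mathbb R}\overline\sigma\big(G(j\omega)\big)$$ be the $H_\infty$-norm, where $\overline\sigma$ is the largest singular value, and let $$\|G\|_{\rm pk\_gn}=\sup_{0\neq u\in L^\infty([0,\infty),\mathbb R^p)}\frac{\|G\ast u\|_{\infty,\infty}}{\|u\|_{\infty,\infty}},\qquad (G\ast u)(t)=\int_0^t Ce^{A(t-\tau)}B\,u(\tau)\,d\tau+Du(t),$$ be the peak-to-peak gain, where $\|u\|_{\infty,\infty}=\operatorname{ess\,sup}_{t\ge 0}\max_i|u_i(t)|$; the response $G\ast u$ does not depend on the realization $(A,B,C,D)$ of $G$. Then $\|G\|_\infty<\infty$ and $$m^{-1/2}\,\|G\|_\infty\le\|G\|_{\rm pk\_gn}\le(2n+1)\,p^{1/2}\,\|G\|_\infty .$$ -/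

import Mathlib

open MeasureTheory
open scoped ENNReal

noncomputable section

namespace LTI

/-- A real state-space system `ẋ = A x + B u`, `y = C x + D u` with `N` states,
`p` inputs and `m` outputs. -/
structure StateSpace (N m p : ℕ) where
  A : Matrix (Fin N) (Fin N) ℝ
  B : Matrix (Fin N) (Fin p) ℝ
  C : Matrix (Fin m) (Fin N) ℝ
  D : Matrix (Fin m) (Fin p) ℝ

namespace StateSpace

variable {N m p : ℕ} (S : StateSpace N m p)

/-- The transfer matrix `C (s I - A)⁻¹ B + D`, a matrix of real rational functions of `s`. -/
def transfer : Matrix (Fin m) (Fin p) (RatFunc ℝ) :=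
  S.C.map RatFunc.C *
      (Matrix.scalar (Fin N) (RatFunc.X : RatFunc ℝ) - S.A.map RatFunc.C)⁻¹ *
      S.B.map RatFunc.C
    + S.D.map RatFunc.C

/-- The absolutely continuous part `C e^{At} B` of the impulse response. -/
def kernel (t : ℝ) : Matrix (Fin m) (Fin p) ℝ :=
  S.C * NormedSpace.exp (t • S.A) * S.B

/-- The response `y = G ∗ u` to the input `u`, from the initial state `x(0) = 0`:
`y(t) = ∫₀ᵗ C e^{A(t-τ)} B u(τ) dτ + D u(t)`. -/
def response (u : ℝ → Fin p → ℝ) (t : ℝ) : Fin m → ℝ :=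
  (∫ τ in (0 : ℝ)..t, (S.kernel (t - τ)).mulVec (u τ)) + S.D.mulVec (u t)

end StateSpace

variable {m p : ℕ}

/-- The McMillan degree (number of poles, counted with multiplicity) of a proper rational matrix:
the state dimension of a minimal realization. -/
def mcmillanDegree (G : Matrix (Fin m) (Fin p) (RatFunc ℝ)) : ℕ :=
  sInf {N : ℕ | ∃ S : StateSpace N m p, S.transfer = G}

/-- A real-rational system is stable if it is proper and all its poles, that is, all the poles
of its entries, lie in the open left half-plane. -/
def IsStable (G : Matrix (Fin m) (Fin p) (RatFunc ℝ)) : Prop :=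
  ∀ i j, (G i j).num.natDegree ≤ (G i j).denom.natDegree ∧
    ∀ z : ℂ, Polynomial.aeval z (G i j).denom = 0 → z.re < 0

/-- The value `G(s)` at a complex number `s`. -/
def evalAt (G : Matrix (Fin m) (Fin p) (RatFunc ℝ)) (s : ℂ) : Matrix (Fin m) (Fin p) ℂ :=
  G.map (RatFunc.eval (algebraMap ℝ ℂ) s)

open scoped Matrix.Norms.L2Operator in
/-- The `H∞` norm `sup_ω σ̄(G(jω))` of a stable system; `σ̄`, the largest singular value,
is the operator norm for the Euclidean norms. -/
def hinfNorm (G : Matrix (Fin m) (Fin p) (RatFunc ℝ)) : ℝ≥0∞ :=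
  ⨆ ω : ℝ, ENNReal.ofReal ‖evalAt G (ω * Complex.I)‖

/-- The signal norm `‖u‖_{∞,∞}`: the essential supremum over `t ≥ 0` of `max_i |u_i(t)|`
(the norm of `Fin k → ℝ` is the maximum norm). -/
def signalNorm {k : ℕ} (u : ℝ → Fin k → ℝ) : ℝ≥0∞ :=
  eLpNorm u ∞ (volume.restrict (Set.Ici (0 : ℝ)))

/-- `y = G ∗ u`. Realizations with the same transfer matrix have the same response, so it does
not matter which one is used. -/
def IsResponse (G : Matrix (Fin m) (Fin p) (RatFunc ℝ))
    (u : ℝ → Fin p → ℝ) (y : ℝ → Fin m → ℝ) : Prop :=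
  ∃ (N : ℕ) (S : StateSpace N m p), S.transfer = G ∧ y = S.response u

/-- The peak-to-peak gain `sup_{u ≠ 0} ‖G ∗ u‖_{∞,∞} / ‖u‖_{∞,∞}`, over all nonzero inputs `u`
in `L∞([0,∞), ℝᵖ)`. -/
def peakGain (G : Matrix (Fin m) (Fin p) (RatFunc ℝ)) : ℝ≥0∞ :=
  ⨆ (u : ℝ → Fin p → ℝ) (y : ℝ → Fin m → ℝ)
    (_ : MemLp u ∞ (volume.restrict (Set.Ici (0 : ℝ)))) (_ : signalNorm u ≠ 0)
    (_ : IsResponse G u y), signalNorm y / signalNorm u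

end LTI

end

/-! Upper bound. The peak-to-peak gain is at most the largest sum, over a row of `G`, of the L¹
norms of the impulse response and the absolute values of the feedthrough. By
`response_eq_of_transfer_eq` the response may be computed in any realization. A minimal one may be
taken reachable and observable, and stability of `G` then makes its `A` Hurwitz
(`isHurwitz_of_reachable_observable`). A change of coordinates makes the reachability Gramian the
identity: `A + Aᵀ = -B Bᵀ` (`exists_inputNormal`).

Let `γ > ‖G‖_∞`. In these coordinates the observability Gramian `V` satisfies `V ≤ γ²`
(`gramian_le_of_hinf_le`), which is the bound of the Hankel operator by the `H∞` norm. So `tr V ≤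
nγ²`. Writing `C e^{At} B = (C e^{At/2})(e^{At/2} B)`, Cauchy–Schwarz and the weighted
arithmetic-geometric mean bound a row of the kernel by `√p (γ⁻¹‖C e^{At/2}‖² + γ‖e^{At/2} B‖²)/2` in
Frobenius norms. The two energies integrate to at most `2 tr V` and `2n`, which gives `2n√p γ`
(`integral_sum_abs_kernel_le`). The feedthrough is the limit of `G(jω)` as `ω → ∞` and adds `√p γ`.
Finally `γ` decreases to `‖G‖_∞`.

Lower bound. The input `Re(v e^{jω(t-T)})` has peak at most `|v|₂`, and for large `T` its response
at time `T` is close to `Re(G(jω)v)`. Each entry of `G(jω)v` is therefore at most the gain times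
`|v|₂`, and summing the squares of `m` entries costs `√m`.

Gramian facts are proved in the frequency domain: with `R` the resolvent, Cauchy's theorem in the
right half-plane gives `∫ Re xᵀR(jω)y dω = π x·y` and `∫ xᵀRQRy dω = 0`. Positivity and unique
solvability of Lyapunov equations follow from the first; the Gramian bound uses both. -/

namespace LTI

open scoped Matrix

/-! ### Transfer matrices over the rational functions, Markov parameters, independence of the
realization. -/

section Algebra

variable {N N' m p : ℕ}

/-- The resolvent `(s I - A)⁻¹` over the field of rational functions of `s`. -/
noncomputable def ratResolvent (A : Matrix (Fin N) (Fin N) ℝ) :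
    Matrix (Fin N) (Fin N) (RatFunc ℝ) :=
  (Matrix.scalar (Fin N) (RatFunc.X : RatFunc ℝ) - A.map RatFunc.C)⁻¹

theorem charmatrix_map_ratFunc (A : Matrix (Fin N) (Fin N) ℝ) :
    A.charmatrix.map (algebraMap (Polynomial ℝ) (RatFunc ℝ)) =
      Matrix.scalar (Fin N) (RatFunc.X : RatFunc ℝ) - A.map RatFunc.C := by
  ext i j
  by_cases h : i = j
  · subst h; simp
  · simp [Matrix.charmatrix_apply_ne _ _ _ h, Matrix.diagonal_apply_ne _ h]

theorem isUnit_det_ratFunc (A : Matrix (Fin N) (Fin N) ℝ) :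
    IsUnit (Matrix.scalar (Fin N) (RatFunc.X : RatFunc ℝ) - A.map RatFunc.C).det := by
  rw [← charmatrix_map_ratFunc]
  have := (algebraMap (Polynomial ℝ) (RatFunc ℝ)).map_det A.charmatrix
  rw [RingHom.mapMatrix_apply] at this
  rw [← this, isUnit_iff_ne_zero]
  have h : A.charpoly ≠ 0 := A.charpoly_monic.ne_zero
  simpa [Matrix.charpoly] using h

theorem sub_mul_ratResolvent (A : Matrix (Fin N) (Fin N) ℝ) :
    (Matrix.scalar (Fin N) (RatFunc.X : RatFunc ℝ) - A.map RatFunc.C) * ratResolvent A = 1 :=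
  Matrix.mul_nonsing_inv _ (isUnit_det_ratFunc A)

theorem ratResolvent_mul_sub (A : Matrix (Fin N) (Fin N) ℝ) :
    ratResolvent A * (Matrix.scalar (Fin N) (RatFunc.X : RatFunc ℝ) - A.map RatFunc.C) = 1 :=
  Matrix.nonsing_inv_mul _ (isUnit_det_ratFunc A)

theorem X_smul_ratResolvent (A : Matrix (Fin N) (Fin N) ℝ) :
    (RatFunc.X : RatFunc ℝ) • ratResolvent A = A.map RatFunc.C * ratResolvent A + 1 := by
  have h := sub_mul_ratResolvent A
  rw [sub_mul, Matrix.scalar_apply, ← Matrix.smul_one_eq_diagonal, Matrix.smul_mul, one_mul] at h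
  rw [← h]; abel

theorem map_C_mul {a b c : ℕ} (A : Matrix (Fin a) (Fin b) ℝ) (B : Matrix (Fin b) (Fin c) ℝ) :
    (A * B).map (RatFunc.C : ℝ →+* RatFunc ℝ) = A.map RatFunc.C * B.map RatFunc.C :=
  Matrix.map_mul

open scoped Classical in
/-- The valuation at infinity of the field of real rational functions. -/
noncomputable def inftyVal : Valuation (RatFunc ℝ) (WithZero (Multiplicative ℤ)) :=
  RatFunc.inftyValuation ℝ

theorem inftyVal_X : inftyVal RatFunc.X = WithZero.exp 1 := by
  classical exact RatFunc.inftyValuation.X ℝ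

theorem inftyVal_polynomial {q : Polynomial ℝ} (hq : q ≠ 0) :
    inftyVal (algebraMap (Polynomial ℝ) (RatFunc ℝ) q) = WithZero.exp (q.natDegree : ℤ) := by
  classical exact RatFunc.inftyValuation.polynomial ℝ hq

theorem inftyValuation_C_le_one (a : ℝ) : inftyVal (RatFunc.C a) ≤ 1 := by
  by_cases h : a = 0
  · simp [h]
  · classical exact (RatFunc.inftyValuation.C ℝ h).le

/-- A rational solution of `s x = A x + b` is strictly proper. -/
theorem inftyValuation_lt_one_of_X_mul_eq (A : Matrix (Fin N) (Fin N) ℝ) (b : Fin N → ℝ)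
    (x : Fin N → RatFunc ℝ)
    (h : ∀ i, RatFunc.X * x i = ∑ j, RatFunc.C (A i j) * x j + RatFunc.C (b i)) (i : Fin N) :
    inftyVal (x i) < 1 := by
  -- At an entry of largest valuation, if that valuation is at least 1, the right-hand side of the
  -- equation does not exceed it, while the factor `X` on the left strictly raises it.
  obtain ⟨k, -, hk⟩ := Finset.exists_max_image Finset.univ
    (fun i => inftyVal (x i)) ⟨i, Finset.mem_univ i⟩
  refine lt_of_le_of_lt (hk i (Finset.mem_univ _)) ?_
  by_contra! hge
  have h1 : inftyVal (RatFunc.X * x k) ≤ inftyVal (x k) := by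
    rw [h k]
    refine Valuation.map_add_le _ (Valuation.map_sum_le _ fun j _ => ?_)
      ((inftyValuation_C_le_one _).trans hge)
    rw [map_mul]
    exact (mul_le_of_le_one_left' (inftyValuation_C_le_one _)).trans (hk j (Finset.mem_univ _))
  have h0 : 0 < inftyVal (x k) := lt_of_lt_of_le zero_lt_one hge
  rw [map_mul, inftyVal_X] at h1
  have h2 : (1 : WithZero (Multiplicative ℤ)) < WithZero.exp 1 := by
    rw [← WithZero.exp_zero, WithZero.exp_lt_exp]; exact one_pos
  have h3 := mul_lt_mul_of_pos_right h2 h0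
  rw [one_mul] at h3
  exact absurd h1 (not_le.mpr h3)

theorem inftyValuation_resolvent_lt_one (C : Matrix (Fin m) (Fin N) ℝ)
    (A : Matrix (Fin N) (Fin N) ℝ) (B : Matrix (Fin N) (Fin p) ℝ) (i : Fin m) (j : Fin p) :
    inftyVal
      ((C.map RatFunc.C * ratResolvent A * B.map RatFunc.C : Matrix _ _ (RatFunc ℝ)) i j) < 1 := by
  rw [Matrix.mul_assoc, Matrix.mul_apply]
  refine Valuation.map_sum_lt _ one_ne_zero fun k _ => ?_
  rw [map_mul]
  refine lt_of_le_of_lt (mul_le_of_le_one_left' (inftyValuation_C_le_one _)) ?_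
  refine inftyValuation_lt_one_of_X_mul_eq A (fun i => B i j)
    (fun k => (ratResolvent A * B.map RatFunc.C : Matrix _ _ (RatFunc ℝ)) k j) (fun i => ?_) k
  have h : (RatFunc.X : RatFunc ℝ) • (ratResolvent A * B.map RatFunc.C) =
      A.map RatFunc.C * (ratResolvent A * B.map RatFunc.C) + B.map RatFunc.C := by
    rw [← Matrix.smul_mul, X_smul_ratResolvent, Matrix.add_mul, Matrix.one_mul, Matrix.mul_assoc]
  have h2 := congrFun (congrFun h i) j
  rw [Matrix.smul_apply, Matrix.add_apply, Matrix.mul_apply] at h2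
  exact h2

theorem polynomial_eq_zero_of_inftyValuation_lt_one {q : Polynomial ℝ}
    (h : inftyVal (algebraMap (Polynomial ℝ) (RatFunc ℝ) q) < 1) : q = 0 := by
  by_contra hq
  rw [inftyVal_polynomial hq, ← WithZero.exp_zero, WithZero.exp_lt_exp] at h
  omega

/-- Multiplication by `s` shifts the Markov sequence: it splits off the first parameter and replaces
`C` by `C A`. This drives the induction that reads off all Markov parameters. -/
theorem X_smul_resolvent (C : Matrix (Fin m) (Fin N) ℝ)
    (A : Matrix (Fin N) (Fin N) ℝ) (B : Matrix (Fin N) (Fin p) ℝ) :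
    (RatFunc.X : RatFunc ℝ) • (C.map RatFunc.C * ratResolvent A * B.map RatFunc.C) =
      (C * A).map RatFunc.C * ratResolvent A * B.map RatFunc.C + (C * B).map RatFunc.C := by
  rw [← Matrix.smul_mul, ← Matrix.mul_smul, X_smul_ratResolvent, map_C_mul, map_C_mul]
  simp only [Matrix.mul_add, Matrix.add_mul, Matrix.mul_one, Matrix.mul_assoc]

/-- If the difference of two strictly proper transfer matrices is polynomial, the Markov
parameters agree. -/
theorem markov_eq_of_sub_polynomial (A : Matrix (Fin N) (Fin N) ℝ) (B : Matrix (Fin N) (Fin p) ℝ)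
    (A' : Matrix (Fin N') (Fin N') ℝ) (B' : Matrix (Fin N') (Fin p) ℝ) (k : ℕ) :
    ∀ (C : Matrix (Fin m) (Fin N) ℝ) (C' : Matrix (Fin m) (Fin N') ℝ)
      (P : Matrix (Fin m) (Fin p) (Polynomial ℝ)),
      C.map RatFunc.C * ratResolvent A * B.map RatFunc.C
        - C'.map RatFunc.C * ratResolvent A' * B'.map RatFunc.C
        = P.map (algebraMap (Polynomial ℝ) (RatFunc ℝ)) →
      P = 0 ∧ C * A ^ k * B = C' * A' ^ k * B' := by
  have key : ∀ (C : Matrix (Fin m) (Fin N) ℝ) (C' : Matrix (Fin m) (Fin N') ℝ)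
      (P : Matrix (Fin m) (Fin p) (Polynomial ℝ)),
      C.map RatFunc.C * ratResolvent A * B.map RatFunc.C
        - C'.map RatFunc.C * ratResolvent A' * B'.map RatFunc.C
        = P.map (algebraMap (Polynomial ℝ) (RatFunc ℝ)) → P = 0 := by
    intro C C' P h
    ext1 i j
    apply polynomial_eq_zero_of_inftyValuation_lt_one
    have := congrFun (congrFun h i) j
    rw [Matrix.sub_apply, Matrix.map_apply] at this
    rw [← this]
    exact Valuation.map_sub_lt _ (inftyValuation_resolvent_lt_one C A B i j)
      (inftyValuation_resolvent_lt_one C' A' B' i j)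
  have step : ∀ (C : Matrix (Fin m) (Fin N) ℝ) (C' : Matrix (Fin m) (Fin N') ℝ)
      (P : Matrix (Fin m) (Fin p) (Polynomial ℝ)),
      C.map RatFunc.C * ratResolvent A * B.map RatFunc.C
        - C'.map RatFunc.C * ratResolvent A' * B'.map RatFunc.C
        = P.map (algebraMap (Polynomial ℝ) (RatFunc ℝ)) →
      (C * A).map RatFunc.C * ratResolvent A * B.map RatFunc.C
        - (C' * A').map RatFunc.C * ratResolvent A' * B'.map RatFunc.C
        = ((C' * B' - C * B).map Polynomial.C).map (algebraMap (Polynomial ℝ) (RatFunc ℝ)) := by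
    intro C C' P h
    have hP := key C C' P h
    have h2 := congrArg (fun M => (RatFunc.X : RatFunc ℝ) • M) h
    simp only [smul_sub, X_smul_resolvent, hP] at h2
    ext1 i j
    have := congrFun (congrFun h2 i) j
    simp only [Matrix.add_apply, Matrix.sub_apply, Matrix.map_apply, Matrix.smul_apply,
      Matrix.zero_apply, map_zero, smul_zero, RatFunc.algebraMap_C, map_sub] at this ⊢
    linear_combination this
  induction k with
  | zero =>
    intro C C' P h
    refine ⟨key C C' P h, ?_⟩
    have := key _ _ _ (step C C' P h)
    ext i j
    have := congrFun (congrFun this i) j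
    simp only [Matrix.map_apply, Matrix.sub_apply, Matrix.zero_apply, Polynomial.C_eq_zero] at this
    simp only [pow_zero, Matrix.mul_one]
    linarith
  | succ k ih =>
    intro C C' P h
    refine ⟨key C C' P h, ?_⟩
    have := (ih _ _ _ (step C C' P h)).2
    rwa [pow_succ', pow_succ', ← Matrix.mul_assoc, ← Matrix.mul_assoc]

theorem transfer_eq (S : StateSpace N m p) :
    S.transfer = S.C.map RatFunc.C * ratResolvent S.A * S.B.map RatFunc.C + S.D.map RatFunc.C :=
  rfl

theorem D_and_markov_eq_of_transfer_eq (S : StateSpace N m p) (S' : StateSpace N' m p)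
    (h : S.transfer = S'.transfer) :
    S.D = S'.D ∧ ∀ k, S.C * S.A ^ k * S.B = S'.C * S'.A ^ k * S'.B := by
  rw [transfer_eq, transfer_eq] at h
  have h1 : S.C.map RatFunc.C * ratResolvent S.A * S.B.map RatFunc.C
      - S'.C.map RatFunc.C * ratResolvent S'.A * S'.B.map RatFunc.C
      = ((S'.D - S.D).map Polynomial.C).map (algebraMap (Polynomial ℝ) (RatFunc ℝ)) := by
    ext1 i j
    have := congrFun (congrFun h i) j
    simp only [Matrix.add_apply, Matrix.sub_apply, Matrix.map_apply, RatFunc.algebraMap_C,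
      map_sub] at this ⊢
    linear_combination this
  refine ⟨?_, fun k => (markov_eq_of_sub_polynomial _ _ _ _ k _ _ _ h1).2⟩
  have := (markov_eq_of_sub_polynomial _ _ _ _ 0 _ _ _ h1).1
  ext i j
  have := congrFun (congrFun this i) j
  simp only [Matrix.map_apply, Matrix.sub_apply, Matrix.zero_apply, Polynomial.C_eq_zero] at this
  linarith

-- The Taylor coefficients of the kernel are Markov parameters up to factorials, so the transfer
-- matrix determines the kernel.
open scoped Matrix.Norms.L2Operator in
theorem hasSum_kernel (S : StateSpace N m p) (t : ℝ) :
    HasSum (fun k : ℕ => (k.factorial : ℝ)⁻¹ • t ^ k • (S.C * S.A ^ k * S.B)) (S.kernel t) := by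
  have h := NormedSpace.exp_series_hasSum_exp' (𝕂 := ℝ) (t • S.A)
  have h2 := h.map (AddMonoidHom.mk' (fun M : Matrix (Fin N) (Fin N) ℝ => S.C * M * S.B)
    fun M M' => by rw [Matrix.mul_add, Matrix.add_mul])
    ((continuous_const.matrix_mul continuous_id).matrix_mul continuous_const)
  convert h2 using 2 with k
  · simp [smul_pow, Matrix.mul_smul, Matrix.smul_mul]
  · rfl

theorem kernel_eq_of_transfer_eq (S : StateSpace N m p) (S' : StateSpace N' m p)
    (h : S.transfer = S'.transfer) : S.kernel = S'.kernel := by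
  funext t
  have h1 := hasSum_kernel S t
  simp only [(D_and_markov_eq_of_transfer_eq S S' h).2] at h1
  exact h1.unique (hasSum_kernel S' t)

theorem response_eq_of_transfer_eq (S : StateSpace N m p) (S' : StateSpace N' m p)
    (h : S.transfer = S'.transfer) : S.response = S'.response := by
  funext u t
  rw [StateSpace.response, StateSpace.response, kernel_eq_of_transfer_eq S S' h,
    (D_and_markov_eq_of_transfer_eq S S' h).1]

/-- Systems related by an intertwiner of their states have the same transfer matrix. -/
theorem transfer_eq_of_intertwine (S : StateSpace N m p) (S' : StateSpace N' m p)
    (T : Matrix (Fin N) (Fin N') ℝ) (hA : T * S'.A = S.A * T) (hB : T * S'.B = S.B)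
    (hC : S'.C = S.C * T) (hD : S'.D = S.D) : S'.transfer = S.transfer := by
  have hT : T.map RatFunc.C * ratResolvent S'.A = ratResolvent S.A * T.map RatFunc.C := by
    have h : (Matrix.scalar (Fin N) (RatFunc.X : RatFunc ℝ) - S.A.map RatFunc.C) * T.map RatFunc.C
        = T.map RatFunc.C *
          (Matrix.scalar (Fin N') (RatFunc.X : RatFunc ℝ) - S'.A.map RatFunc.C) := by
      rw [Matrix.sub_mul, Matrix.mul_sub, ← map_C_mul, ← map_C_mul, hA]
      congr 1
      ext i j
      simp [mul_comm]
    calc T.map RatFunc.C * ratResolvent S'.A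
        = ratResolvent S.A * ((Matrix.scalar (Fin N) (RatFunc.X : RatFunc ℝ)
          - S.A.map RatFunc.C) * T.map RatFunc.C) * ratResolvent S'.A := by
          rw [← Matrix.mul_assoc, ratResolvent_mul_sub, Matrix.one_mul]
      _ = _ := by rw [h, Matrix.mul_assoc, Matrix.mul_assoc, sub_mul_ratResolvent, Matrix.mul_one]
  rw [transfer_eq, transfer_eq, hC, hD, map_C_mul, Matrix.mul_assoc (S.C.map _), hT, ← hB,
    map_C_mul]
  simp only [Matrix.mul_assoc]

/-- The dual system. -/
def transposeSystem (S : StateSpace N m p) : StateSpace N p m :=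
  ⟨S.Aᵀ, S.Cᵀ, S.Bᵀ, S.Dᵀ⟩

theorem transfer_transposeSystem (S : StateSpace N m p) :
    (transposeSystem S).transfer = S.transferᵀ := by
  rw [transfer_eq, transfer_eq, Matrix.transpose_add, Matrix.transpose_mul, Matrix.transpose_mul,
    ratResolvent, ratResolvent, Matrix.transpose_nonsing_inv]
  simp only [transposeSystem, Matrix.transpose_sub, Matrix.transpose_map, Matrix.mul_assoc]
  simp

end Algebra

/-! ### Reachable and observable realizations, and why stability makes them Hurwitz. -/

section Realization

variable {N N' m p : ℕ}

/-- The polynomial matrix `q(s)I - q(A)` is divisible by `sI - A`; `Q` is the quotient. -/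
theorem exists_smul_ratResolvent (A : Matrix (Fin N) (Fin N) ℝ) (q : Polynomial ℝ) :
    ∃ Q : Matrix (Fin N) (Fin N) (Polynomial ℝ),
      algebraMap (Polynomial ℝ) (RatFunc ℝ) q • ratResolvent A =
        (Polynomial.aeval A q).map RatFunc.C * ratResolvent A +
          Q.map (algebraMap (Polynomial ℝ) (RatFunc ℝ)) := by
  induction q using Polynomial.induction_on with
  | C a =>
    refine ⟨0, ?_⟩
    have h1 : (Polynomial.aeval A (Polynomial.C a)).map (RatFunc.C : ℝ →+* RatFunc ℝ) =
        (RatFunc.C a : RatFunc ℝ) • (1 : Matrix (Fin N) (Fin N) (RatFunc ℝ)) := by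
      ext i j
      by_cases h : i = j <;>
        simp [Matrix.algebraMap_matrix_apply, h]
    rw [h1, Matrix.smul_mul, Matrix.one_mul, RatFunc.algebraMap_C]
    ext i j
    simp
  | add q r hq hr =>
    obtain ⟨Q, hQ⟩ := hq
    obtain ⟨R, hR⟩ := hr
    refine ⟨Q + R, ?_⟩
    rw [map_add, add_smul, hQ, hR, map_add]
    have h1 : (Polynomial.aeval A q + Polynomial.aeval A r).map (RatFunc.C : ℝ →+* RatFunc ℝ)
        = (Polynomial.aeval A q).map RatFunc.C + (Polynomial.aeval A r).map RatFunc.C :=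
      Matrix.map_add _ (map_add _) _ _
    have h2 : (Q + R).map (algebraMap (Polynomial ℝ) (RatFunc ℝ)) =
        Q.map (algebraMap (Polynomial ℝ) (RatFunc ℝ))
          + R.map (algebraMap (Polynomial ℝ) (RatFunc ℝ)) :=
      Matrix.map_add _ (map_add _) _ _
    rw [h1, h2, Matrix.add_mul]
    abel
  | monomial n a h =>
    obtain ⟨Q, hQ⟩ := h
    refine ⟨(Polynomial.aeval A (Polynomial.C a * Polynomial.X ^ n)).map Polynomial.C
      + (Polynomial.X : Polynomial ℝ) • Q, ?_⟩
    rw [pow_succ, ← mul_assoc]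
    generalize Polynomial.C a * Polynomial.X ^ n = q at hQ ⊢
    rw [map_mul, mul_comm, mul_smul, hQ, smul_add, ← Matrix.mul_smul,
      RatFunc.algebraMap_X, X_smul_ratResolvent, map_mul (Polynomial.aeval A), Polynomial.aeval_X,
      map_C_mul, Matrix.mul_add, Matrix.mul_one, Matrix.mul_assoc, add_assoc]
    congr 1
    ext i j
    simp

/-- A polynomial `q` such that `q G` is polynomial annihilates the Markov parameters. -/
theorem markov_aeval_eq_zero (S : StateSpace N m p) (q : Polynomial ℝ)
    (P : Matrix (Fin m) (Fin p) (Polynomial ℝ))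
    (h : algebraMap (Polynomial ℝ) (RatFunc ℝ) q • S.transfer =
      P.map (algebraMap (Polynomial ℝ) (RatFunc ℝ))) (k : ℕ) :
    S.C * Polynomial.aeval S.A q * S.A ^ k * S.B = 0 := by
  obtain ⟨Q, hQ⟩ := exists_smul_ratResolvent S.A q
  -- The comparison is with a system without states, whose Markov parameters all vanish.
  have h1 : (S.C * Polynomial.aeval S.A q).map RatFunc.C * ratResolvent S.A * S.B.map RatFunc.C
      - (0 : Matrix (Fin m) (Fin 0) ℝ).map RatFunc.C *
        ratResolvent (0 : Matrix (Fin 0) (Fin 0) ℝ) *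
          (0 : Matrix (Fin 0) (Fin p) ℝ).map RatFunc.C
      = (P - q • S.D.map Polynomial.C - S.C.map Polynomial.C * Q * S.B.map Polynomial.C).map
        (algebraMap (Polynomial ℝ) (RatFunc ℝ)) := by
    have e1 : (P - q • S.D.map Polynomial.C - S.C.map Polynomial.C * Q * S.B.map Polynomial.C).map
        (algebraMap (Polynomial ℝ) (RatFunc ℝ)) =
        P.map (algebraMap (Polynomial ℝ) (RatFunc ℝ))
        - algebraMap (Polynomial ℝ) (RatFunc ℝ) q • S.D.map RatFunc.C
        - S.C.map RatFunc.C * Q.map (algebraMap (Polynomial ℝ) (RatFunc ℝ)) *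
          S.B.map RatFunc.C := by
      ext i j
      simp [Matrix.mul_apply, Algebra.smul_def]
    have e2 : S.C.map RatFunc.C * Q.map (algebraMap (Polynomial ℝ) (RatFunc ℝ)) *
          S.B.map RatFunc.C = algebraMap (Polynomial ℝ) (RatFunc ℝ) q •
            (S.C.map RatFunc.C * ratResolvent S.A * S.B.map RatFunc.C)
          - (S.C * Polynomial.aeval S.A q).map RatFunc.C * ratResolvent S.A *
            S.B.map RatFunc.C := by
      rw [← Matrix.smul_mul, ← Matrix.mul_smul, hQ, map_C_mul]
      simp only [Matrix.mul_add, Matrix.add_mul, Matrix.mul_assoc]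
      abel
    rw [e1, e2, ← h, transfer_eq, smul_add]
    simp
  simpa using (markov_eq_of_sub_polynomial _ _ _ _ k _ _ _ h1).2

/-- A pair `(A, B)` is reachable if the vectors `A ^ k B u` span the state space. -/
def IsReachable (A : Matrix (Fin N) (Fin N) ℝ) (B : Matrix (Fin N) (Fin p) ℝ) : Prop :=
  Submodule.span ℝ {x | ∃ (k : ℕ) (u : Fin p → ℝ), x = (A ^ k * B) *ᵥ u} = ⊤

/-- A pair `(C, A)` is observable if only the zero state has zero free output. -/
def IsObservable (C : Matrix (Fin m) (Fin N) ℝ) (A : Matrix (Fin N) (Fin N) ℝ) : Prop :=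
  ∀ x : Fin N → ℝ, (∀ k, (C * A ^ k) *ᵥ x = 0) → x = 0

theorem IsReachable.isObservable_transpose {A : Matrix (Fin N) (Fin N) ℝ}
    {B : Matrix (Fin N) (Fin p) ℝ} (h : IsReachable A B) : IsObservable Bᵀ Aᵀ := by
  intro x hx
  have h1 : ∀ y : Fin N → ℝ, x ⬝ᵥ y = 0 := by
    intro y
    have hy : y ∈ Submodule.span ℝ {x | ∃ (k : ℕ) (u : Fin p → ℝ), x = (A ^ k * B) *ᵥ u} := by
      rw [show Submodule.span ℝ _ = ⊤ from h]; trivial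
    induction hy using Submodule.span_induction with
    | mem y hy =>
      obtain ⟨k, u, rfl⟩ := hy
      rw [Matrix.dotProduct_mulVec, ← Matrix.mulVec_transpose, Matrix.transpose_mul,
        Matrix.transpose_pow, hx k, zero_dotProduct]
    | zero => simp
    | add y z _ _ hy hz => rw [dotProduct_add, hy, hz, add_zero]
    | smul c y _ hy => rw [dotProduct_smul, hy, smul_zero]
  exact dotProduct_self_eq_zero.mp (h1 x)

/-- Restriction of a system to its reachable subspace. -/
theorem exists_reachable_intertwine (S : StateSpace N m p) :
    ∃ (r : ℕ) (S' : StateSpace r m p) (T : Matrix (Fin N) (Fin r) ℝ), r ≤ N ∧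
      T * S'.A = S.A * T ∧ T * S'.B = S.B ∧ S'.C = S.C * T ∧ S'.D = S.D ∧
      Function.Injective T.mulVec ∧ IsReachable S'.A S'.B := by
  set W := Submodule.span ℝ {x | ∃ (k : ℕ) (u : Fin p → ℝ), x = (S.A ^ k * S.B) *ᵥ u} with hW
  let b := Module.finBasis ℝ W
  let f : (Fin (Module.finrank ℝ W) → ℝ) →ₗ[ℝ] (Fin N → ℝ) :=
    W.subtype ∘ₗ b.equivFun.symm.toLinearMap
  have hf : Function.Injective f :=
    W.injective_subtype.comp b.equivFun.symm.injective
  have hfr : ∀ x ∈ W, ∃ y, f y = x := fun x hx => ⟨b.equivFun ⟨x, hx⟩, by simp [f]⟩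
  have hfm : ∀ y, f y ∈ W := fun y => (b.equivFun.symm y).2
  obtain ⟨g, hg⟩ := f.exists_leftInverse_of_injective (LinearMap.ker_eq_bot.mpr hf)
  have hgf : ∀ y, g (f y) = y := fun y => by
    rw [← LinearMap.comp_apply, hg, LinearMap.id_apply]
  have hfg : ∀ x ∈ W, f (g x) = x := by
    rintro x hx
    obtain ⟨y, rfl⟩ := hfr x hx
    rw [hgf]
  set T := LinearMap.toMatrix' f with hT
  set L := LinearMap.toMatrix' g with hL
  have hTf : ∀ y, T *ᵥ y = f y := fun y => by rw [hT, LinearMap.toMatrix'_mulVec]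
  have hLg : ∀ x, L *ᵥ x = g x := fun y => by rw [hL, LinearMap.toMatrix'_mulVec]
  have hWA : ∀ x ∈ W, S.A *ᵥ x ∈ W := by
    intro x hx
    induction hx using Submodule.span_induction with
    | mem y hy =>
      obtain ⟨k, u, rfl⟩ := hy
      refine Submodule.subset_span ⟨k + 1, u, ?_⟩
      rw [Matrix.mulVec_mulVec, pow_succ', Matrix.mul_assoc]
    | zero => simp
    | add y z _ _ hy hz => rw [Matrix.mulVec_add]; exact W.add_mem hy hz
    | smul c y _ hy => rw [Matrix.mulVec_smul]; exact W.smul_mem c hy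
  have hWB : ∀ u, S.B *ᵥ u ∈ W := fun u =>
    Submodule.subset_span ⟨0, u, by rw [pow_zero, Matrix.one_mul]⟩
  have hA : T * (L * S.A * T) = S.A * T := by
    refine Matrix.ext_of_mulVec_single fun i => ?_
    simp only [← Matrix.mulVec_mulVec]
    rw [hTf, hLg, hTf]
    exact hfg _ (hWA _ (hfm _))
  have hB : T * (L * S.B) = S.B := by
    refine Matrix.ext_of_mulVec_single fun i => ?_
    simp only [← Matrix.mulVec_mulVec]
    rw [hTf, hLg]
    exact hfg _ (hWB _)
  refine ⟨_, ⟨L * S.A * T, L * S.B, S.C * T, S.D⟩, T, ?_, hA, hB, rfl, rfl, ?_, ?_⟩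
  · simpa using W.finrank_le
  · intro x y hxy
    rw [hTf, hTf] at hxy
    exact hf hxy
  · have hpow : ∀ k : ℕ, T * ((L * S.A * T) ^ k * (L * S.B)) = S.A ^ k * S.B := by
      intro k
      induction k with
      | zero => rw [pow_zero, pow_zero, Matrix.one_mul, Matrix.one_mul, hB]
      | succ k ih =>
        rw [pow_succ', Matrix.mul_assoc, ← Matrix.mul_assoc T, hA, Matrix.mul_assoc, ih, pow_succ',
          Matrix.mul_assoc]
    rw [IsReachable, Submodule.eq_top_iff']
    intro y
    rw [← hgf y]
    have hy := hfm y
    generalize f y = x at hy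
    induction hy using Submodule.span_induction with
    | mem y hy =>
      obtain ⟨k, u, rfl⟩ := hy
      refine Submodule.subset_span ⟨k, u, ?_⟩
      rw [← hpow, ← Matrix.mulVec_mulVec, hTf, hgf]
    | zero => rw [map_zero]; exact Submodule.zero_mem _
    | add y z _ _ hy hz => rw [map_add]; exact Submodule.add_mem _ hy hz
    | smul c y _ hy => rw [map_smul]; exact Submodule.smul_mem _ c hy

theorem intertwine_pow {A : Matrix (Fin N) (Fin N) ℝ} {A' : Matrix (Fin N') (Fin N') ℝ}
    {T : Matrix (Fin N) (Fin N') ℝ} (h : T * A' = A * T) (k : ℕ) :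
    T * A' ^ k = A ^ k * T := by
  induction k with
  | zero => simp
  | succ k ih => rw [pow_succ, ← Matrix.mul_assoc, ih, Matrix.mul_assoc, h, pow_succ,
      Matrix.mul_assoc]

/-- Every system has a reachable and observable realization of at most the same dimension. -/
theorem exists_reachable_observable (S : StateSpace N m p) :
    ∃ (r : ℕ) (S' : StateSpace r m p), r ≤ N ∧ S'.transfer = S.transfer ∧
      IsReachable S'.A S'.B ∧ IsObservable S'.C S'.A := by
  obtain ⟨r, S₁, T, hr, hA, hB, hC, hD, -, hreach⟩ :=
    exists_reachable_intertwine (transposeSystem S)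
  have h1 := transfer_eq_of_intertwine _ _ T hA hB hC hD
  obtain ⟨r', S₂, T', hr', hA', hB', hC', hD', hinj, hreach'⟩ :=
    exists_reachable_intertwine (transposeSystem S₁)
  have h2 := transfer_eq_of_intertwine _ _ T' hA' hB' hC' hD'
  refine ⟨r', S₂, hr'.trans hr, ?_, hreach', ?_⟩
  · rw [h2, transfer_transposeSystem, h1, transfer_transposeSystem, Matrix.transpose_transpose]
  · intro x hx
    -- Reachability of the dual is observability of its transpose. Restricting to the reachable
    -- subspace then keeps observability, because the inclusion `T'` is injective.
    have hobs := hreach.isObservable_transpose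
    have : T' *ᵥ x = 0 := by
      refine hobs _ fun k => ?_
      rw [Matrix.mulVec_mulVec, Matrix.mul_assoc]
      have := hx k
      rwa [hC', Matrix.mul_assoc, intertwine_pow hA'] at this
    exact hinj (by rw [this, Matrix.mulVec_zero])

/-- A real matrix annihilated by a polynomial with all roots in the open left half-plane. -/
def IsHurwitz (A : Matrix (Fin N) (Fin N) ℝ) : Prop :=
  ∃ q : Polynomial ℝ, Polynomial.aeval A q = 0 ∧
    ∀ z : ℂ, Polynomial.aeval z q = 0 → z.re < 0

/-- A common denominator of the entries of a rational matrix. -/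
noncomputable def commonDenom (G : Matrix (Fin m) (Fin p) (RatFunc ℝ)) : Polynomial ℝ :=
  ∏ ij : Fin m × Fin p, (G ij.1 ij.2).denom

theorem exists_commonDenom_mul (G : Matrix (Fin m) (Fin p) (RatFunc ℝ)) (i : Fin m) (j : Fin p) :
    ∃ r : Polynomial ℝ, commonDenom G = (G i j).denom * r ∧
      algebraMap (Polynomial ℝ) (RatFunc ℝ) (commonDenom G) * G i j =
        algebraMap (Polynomial ℝ) (RatFunc ℝ) ((G i j).num * r) := by
  obtain ⟨r, hr⟩ : ∃ r, commonDenom G = (G i j).denom * r :=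
    ⟨_, (Finset.mul_prod_erase Finset.univ (fun ij : Fin m × Fin p => (G ij.1 ij.2).denom)
      (Finset.mem_univ (i, j))).symm⟩
  refine ⟨r, hr, ?_⟩
  rw [hr]
  nth_rewrite 2 [← RatFunc.num_div_denom (G i j)]
  have : algebraMap (Polynomial ℝ) (RatFunc ℝ) (G i j).denom ≠ 0 :=
    RatFunc.algebraMap_ne_zero (RatFunc.denom_ne_zero _)
  rw [map_mul, map_mul]
  field_simp

theorem monic_commonDenom (G : Matrix (Fin m) (Fin p) (RatFunc ℝ)) : (commonDenom G).Monic :=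
  Polynomial.monic_prod_of_monic _ _ fun _ _ => RatFunc.monic_denom _

theorem re_lt_zero_of_commonDenom_eq_zero {G : Matrix (Fin m) (Fin p) (RatFunc ℝ)}
    (hG : IsStable G) (z : ℂ) (hz : Polynomial.aeval z (commonDenom G) = 0) : z.re < 0 := by
  rw [commonDenom, map_prod, Finset.prod_eq_zero_iff] at hz
  obtain ⟨ij, -, h⟩ := hz
  exact (hG ij.1 ij.2).2 z h

/-- The common denominator `q` of the entries clears the transfer matrix, so `C A^l q(A) A^k B = 0`
for all `k` and `l`. Observability removes the left factors and reachability the right ones, leaving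
`q(A) = 0`. -/
theorem isHurwitz_of_reachable_observable (S : StateSpace N m p) (hS : IsStable S.transfer)
    (hr : IsReachable S.A S.B) (ho : IsObservable S.C S.A) : IsHurwitz S.A := by
  refine ⟨commonDenom S.transfer, ?_, re_lt_zero_of_commonDenom_eq_zero hS⟩
  choose r hr1 hr2 using exists_commonDenom_mul S.transfer
  have h := markov_aeval_eq_zero S (commonDenom S.transfer)
    (Matrix.of fun i j => (S.transfer i j).num * r i j) (by
      ext1 i j
      rw [Matrix.smul_apply, smul_eq_mul, hr2]
      rfl)
  set M := Polynomial.aeval S.A (commonDenom S.transfer) with hM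
  have hcomm : ∀ k : ℕ, S.A ^ k * M = M * S.A ^ k := fun k => by
    have := (Commute.all (Polynomial.X ^ k) (commonDenom S.transfer)).map (Polynomial.aeval S.A)
    rw [map_pow, Polynomial.aeval_X] at this
    exact this
  refine Matrix.ext_of_mulVec_single fun i => ?_
  rw [Matrix.zero_mulVec]
  generalize (Pi.single i 1 : Fin N → ℝ) = x
  have hx : x ∈ Submodule.span ℝ {x | ∃ (k : ℕ) (u : Fin p → ℝ), x = (S.A ^ k * S.B) *ᵥ u} := by
    rw [show Submodule.span ℝ _ = ⊤ from hr]; trivial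
  induction hx using Submodule.span_induction with
  | mem y hy =>
    obtain ⟨k, u, rfl⟩ := hy
    refine ho _ fun l => ?_
    rw [Matrix.mulVec_mulVec, Matrix.mulVec_mulVec]
    have := h (l + k)
    rw [pow_add] at this
    simp only [Matrix.mul_assoc] at this ⊢
    rw [← Matrix.mul_assoc (S.A ^ l) M, hcomm l, Matrix.mul_assoc, this, Matrix.zero_mulVec]
  | zero => simp
  | add y z _ _ hy hz => rw [Matrix.mulVec_add, hy, hz, add_zero]
  | smul c y _ hy => rw [Matrix.mulVec_smul, hy, smul_zero]

end Realization

/-! ### Existence of a realization of a proper matrix. -/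

section Companion

variable {m p : ℕ}

/-- The companion matrix of a monic polynomial of degree `d`. -/
noncomputable def companion (q : Polynomial ℝ) (d : ℕ) : Matrix (Fin d) (Fin d) ℝ :=
  Matrix.of fun k l => if (k : ℕ) + 1 = d then -q.coeff l else if (l : ℕ) = k + 1 then 1 else 0

/-- The vector `(1, s, …, s^{d-1})/q` solves `(sI - A)v = e_d` for the companion matrix `A`. Its
entries are the building blocks of every strictly proper function with denominator `q`. -/
theorem companion_mul_pow (q : Polynomial ℝ) (hq : q.Monic) (k : Fin q.natDegree) :
    (RatFunc.X : RatFunc ℝ) * (RatFunc.X ^ (k : ℕ) / algebraMap (Polynomial ℝ) (RatFunc ℝ) q) -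
      ∑ l : Fin q.natDegree, RatFunc.C (companion q q.natDegree k l) *
        (RatFunc.X ^ (l : ℕ) / algebraMap (Polynomial ℝ) (RatFunc ℝ) q) =
      if (k : ℕ) + 1 = q.natDegree then 1 else 0 := by
  have hq0 : algebraMap (Polynomial ℝ) (RatFunc ℝ) q ≠ 0 :=
    RatFunc.algebraMap_ne_zero hq.ne_zero
  by_cases hk : (k : ℕ) + 1 = q.natDegree
  · have h1 : algebraMap (Polynomial ℝ) (RatFunc ℝ) q = RatFunc.X ^ q.natDegree +
        ∑ l : Fin q.natDegree, RatFunc.C (q.coeff l) * RatFunc.X ^ (l : ℕ) := by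
      conv_lhs => rw [hq.as_sum]
      rw [Finset.sum_range]
      simp
    rw [if_pos hk]
    simp only [companion, Matrix.of_apply, if_pos hk, mul_div_assoc']
    rw [← Finset.sum_div, ← sub_div, div_eq_one_iff_eq hq0, ← pow_succ', hk]
    rw [h1]
    simp
  · rw [if_neg hk]
    have hlt : (k : ℕ) + 1 < q.natDegree := by omega
    rw [Finset.sum_eq_single ⟨k + 1, hlt⟩]
    · simp only [companion, Matrix.of_apply, if_neg hk, if_true, map_one, one_mul]
      rw [pow_succ']
      ring
    · intro l _ hl
      have : ¬ (l : ℕ) = k + 1 := fun h => hl (Fin.ext h)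
      simp [companion, if_neg hk, if_neg this]
    · simp

/-- A proper rational matrix has a realization. -/
theorem exists_realization (G : Matrix (Fin m) (Fin p) (RatFunc ℝ))
    (hG : ∀ i j, (G i j).num.natDegree ≤ (G i j).denom.natDegree) :
    ∃ (N : ℕ) (S : StateSpace N m p), S.transfer = G := by
  set q := commonDenom G with hqdef
  have hq : q.Monic := monic_commonDenom G
  have hq0 : algebraMap (Polynomial ℝ) (RatFunc ℝ) q ≠ 0 :=
    RatFunc.algebraMap_ne_zero hq.ne_zero
  choose r hr1 hr2 using exists_commonDenom_mul G
  set d := q.natDegree with hd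
  set P : Fin m → Fin p → Polynomial ℝ := fun i j => (G i j).num * r i j with hP
  have hPdeg : ∀ i j, (P i j).natDegree ≤ d := by
    intro i j
    have hr0 : r i j ≠ 0 := by
      intro h
      have := hr1 i j
      rw [h, mul_zero] at this
      exact hq.ne_zero this
    rw [hd, hqdef, hr1 i j, Polynomial.natDegree_mul (RatFunc.denom_ne_zero _) hr0]
    exact Polynomial.natDegree_mul_le.trans (Nat.add_le_add_right (hG i j) _)
  have hGP : ∀ i j, G i j = RatFunc.C ((P i j).coeff d) +
      ∑ l : Fin d, RatFunc.C ((P i j).coeff l - (P i j).coeff d * q.coeff l) *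
        (RatFunc.X ^ (l : ℕ) / algebraMap (Polynomial ℝ) (RatFunc ℝ) q) := by
    intro i j
    have h1 : algebraMap (Polynomial ℝ) (RatFunc ℝ) (P i j) =
        RatFunc.C ((P i j).coeff d) * RatFunc.X ^ d +
        ∑ l : Fin d, RatFunc.C ((P i j).coeff l) * RatFunc.X ^ (l : ℕ) := by
      conv_lhs => rw [(P i j).as_sum_range' (d + 1) (Nat.lt_succ_of_le (hPdeg i j))]
      rw [Finset.sum_range_succ, Finset.sum_range, add_comm]
      simp [← Polynomial.C_mul_X_pow_eq_monomial]
    have h2 : algebraMap (Polynomial ℝ) (RatFunc ℝ) q = RatFunc.X ^ d +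
        ∑ l : Fin d, RatFunc.C (q.coeff l) * RatFunc.X ^ (l : ℕ) := by
      conv_lhs => rw [hq.as_sum]
      rw [Finset.sum_range]
      simp only [map_add, map_pow, map_sum, map_mul, RatFunc.algebraMap_X, RatFunc.algebraMap_C]
      rfl
    have h3 : G i j = algebraMap (Polynomial ℝ) (RatFunc ℝ) (P i j) /
        algebraMap (Polynomial ℝ) (RatFunc ℝ) q := by
      rw [eq_div_iff hq0, mul_comm]
      exact hr2 i j
    simp only [mul_div_assoc']
    rw [h3, ← Finset.sum_div, div_eq_iff hq0, add_mul, div_mul_cancel₀ _ hq0, h1, h2]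
    simp only [map_sub, map_mul, sub_mul, Finset.sum_sub_distrib, mul_add, Finset.mul_sum,
      mul_assoc]
    ring
  let e : Fin p × Fin d ≃ Fin (p * d) := finProdFinEquiv
  -- One companion block for each input; `C` holds the numerators after division by `q`, and `D`
  -- their coefficients of degree `d`.
  let S : StateSpace (p * d) m p :=
    { A := Matrix.of fun x y => if (e.symm x).1 = (e.symm y).1 then
        companion q d (e.symm x).2 (e.symm y).2 else 0
      B := Matrix.of fun x j => if (e.symm x).1 = j ∧ ((e.symm x).2 : ℕ) + 1 = d then 1 else 0
      C := Matrix.of fun i x => (P i (e.symm x).1).coeff (e.symm x).2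
        - (P i (e.symm x).1).coeff d * q.coeff (e.symm x).2
      D := Matrix.of fun i j => (P i j).coeff d }
  refine ⟨p * d, S, ?_⟩
  let V : Matrix (Fin (p * d)) (Fin p) (RatFunc ℝ) := Matrix.of fun x j =>
    if (e.symm x).1 = j then
      RatFunc.X ^ ((e.symm x).2 : ℕ) / algebraMap (Polynomial ℝ) (RatFunc ℝ) q else 0
  have hV : (Matrix.scalar (Fin (p * d)) (RatFunc.X : RatFunc ℝ) - S.A.map RatFunc.C) * V
      = S.B.map RatFunc.C := by
    ext1 x j
    rw [Matrix.sub_mul, Matrix.sub_apply, Matrix.scalar_apply, Matrix.diagonal_mul,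
      Matrix.mul_apply, ← e.sum_comp, Fintype.sum_prod_type]
    simp only [V, S, Matrix.of_apply, Matrix.map_apply, Equiv.symm_apply_apply]
    by_cases hj : (e.symm x).1 = j
    · rw [Finset.sum_eq_single j]
      · have := companion_mul_pow q hq (e.symm x).2
        simp only [hj, if_true, true_and]
        rw [this]
        split_ifs <;> simp
      · intro b _ hb
        simp [hb]
      · simp
    · simp only [hj, if_false, false_and, mul_zero, map_zero, zero_sub, neg_eq_zero]
      refine Finset.sum_eq_zero fun b _ => Finset.sum_eq_zero fun l _ => ?_
      by_cases hb : b = j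
      · subst hb; simp [hj]
      · simp [hb]
  have hR : ratResolvent S.A * S.B.map RatFunc.C = V := by
    rw [← hV, ← Matrix.mul_assoc, ratResolvent_mul_sub, Matrix.one_mul]
  rw [transfer_eq, Matrix.mul_assoc, hR]
  ext1 i j
  rw [hGP i j, Matrix.add_apply, add_comm, Matrix.mul_apply, ← e.sum_comp, Fintype.sum_prod_type,
    Finset.sum_eq_single j]
  · simp only [V, S, Matrix.of_apply, Matrix.map_apply, Equiv.symm_apply_apply, if_true]
  · intro b _ hb
    simp [V, hb]
  · simp

end Companion

/-! ### Values of the transfer matrix on the closed right half-plane. -/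

section Evaluation

variable {N m p : ℕ}

/-- A real matrix viewed as a complex one. -/
def toC {a b : ℕ} (M : Matrix (Fin a) (Fin b) ℝ) : Matrix (Fin a) (Fin b) ℂ :=
  M.map Complex.ofReal

theorem toC_mul {a b c : ℕ} (M : Matrix (Fin a) (Fin b) ℝ) (M' : Matrix (Fin b) (Fin c) ℝ) :
    toC (M * M') = toC M * toC M' := by
  ext i j
  simp [toC, Matrix.mul_apply]

theorem toC_add {a b : ℕ} (M M' : Matrix (Fin a) (Fin b) ℝ) :
    toC (M + M') = toC M + toC M' := by
  ext i j
  simp [toC]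

theorem toC_neg {a b : ℕ} (M : Matrix (Fin a) (Fin b) ℝ) : toC (-M) = -toC M := by
  ext i j
  simp [toC]

theorem toC_transpose {a b : ℕ} (M : Matrix (Fin a) (Fin b) ℝ) : toC Mᵀ = (toC M)ᵀ := rfl

theorem toC_one : toC (1 : Matrix (Fin N) (Fin N) ℝ) = 1 := by
  ext i j
  by_cases h : i = j
  · subst h; simp [toC]
  · simp [toC, h]

theorem toC_conjTranspose {a b : ℕ} (M : Matrix (Fin a) (Fin b) ℝ) : (toC M)ᴴ = toC Mᵀ := by
  ext i j
  simp [toC]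

theorem toC_aeval (A : Matrix (Fin N) (Fin N) ℝ) (q : Polynomial ℝ) :
    toC (Polynomial.aeval A q) = Polynomial.aeval (toC A) q := by
  have := Polynomial.aeval_algHom_apply (Complex.ofRealAm.mapMatrix (m := Fin N)) A q
  exact this.symm

/-- The complex resolvent `(s I - A)⁻¹`. -/
noncomputable def cRes (A : Matrix (Fin N) (Fin N) ℝ) (s : ℂ) : Matrix (Fin N) (Fin N) ℂ :=
  resolvent (toC A) s

/-- By spectral mapping an eigenvalue `s` gives `q(s)` in the spectrum of `q(A) = 0`, so `q(s) = 0`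
and `Re s < 0`. -/
theorem IsHurwitz.mem_resolventSet {A : Matrix (Fin N) (Fin N) ℝ} (hA : IsHurwitz A) {s : ℂ}
    (hs : 0 ≤ s.re) : s ∈ resolventSet ℂ (toC A) := by
  obtain ⟨q, hq, hroot⟩ := hA
  by_contra hmem
  have hmem' : s ∈ spectrum ℂ (toC A) := hmem
  have h1 := spectrum.subset_polynomial_aeval (𝕜 := ℂ) (toC A)
    (q.map (algebraMap ℝ ℂ)) ⟨s, hmem', rfl⟩
  rw [Polynomial.aeval_map_algebraMap, ← toC_aeval, hq] at h1
  -- Without states the matrix algebra is trivial and the spectrum of zero is empty rather than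
  -- `{0}`.
  rcases Nat.eq_zero_or_pos N with hN | hN
  · subst hN
    have := spectrum.of_subsingleton (R := ℂ) (toC (0 : Matrix (Fin 0) (Fin 0) ℝ))
    rw [this] at h1
    exact h1
  · have : Nonempty (Fin N) := ⟨⟨0, hN⟩⟩
    have h0 : toC (0 : Matrix (Fin N) (Fin N) ℝ) = 0 := by ext; simp [toC]
    rw [h0, spectrum.zero_eq, Set.mem_singleton_iff] at h1
    have h2 : Polynomial.aeval s q = 0 := by
      simpa [Polynomial.eval_map_algebraMap] using h1
    exact absurd (hroot s h2) (not_lt.mpr hs)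

theorem IsHurwitz.sub_mul_cRes {A : Matrix (Fin N) (Fin N) ℝ} (hA : IsHurwitz A) {s : ℂ}
    (hs : 0 ≤ s.re) : (algebraMap ℂ _ s - toC A) * cRes A s = 1 :=
  Ring.mul_inverse_cancel _ (hA.mem_resolventSet hs)

theorem IsHurwitz.cRes_mul_sub {A : Matrix (Fin N) (Fin N) ℝ} (hA : IsHurwitz A) {s : ℂ}
    (hs : 0 ≤ s.re) : cRes A s * (algebraMap ℂ _ s - toC A) = 1 :=
  Ring.inverse_mul_cancel _ (hA.mem_resolventSet hs)

/-- Evaluation is defined through the reduced fraction, whereas Cramer's rule gives an unreduced one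
over the characteristic polynomial. Neither denominator vanishes when `Re s ≥ 0`, so
cross-multiplying the polynomial identity suffices. -/
theorem evalAt_transfer (S : StateSpace N m p) (hA : IsHurwitz S.A) (hS : IsStable S.transfer)
    {s : ℂ} (hs : 0 ≤ s.re) :
    evalAt S.transfer s = toC S.C * cRes S.A s * toC S.B + toC S.D := by
  set φ : Polynomial ℝ →+* ℂ := Polynomial.eval₂RingHom (algebraMap ℝ ℂ) s with hφ
  have hchar : S.A.charmatrix.map φ = algebraMap ℂ _ s - toC S.A := by
    ext i j
    by_cases h : i = j
    · subst h; simp [hφ, toC, Matrix.algebraMap_matrix_apply]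
    · simp [hφ, toC, Matrix.algebraMap_matrix_apply, h]
  have hdet : φ S.A.charpoly = (algebraMap ℂ _ s - toC S.A).det := by
    rw [Matrix.charpoly, φ.map_det, RingHom.mapMatrix_apply, hchar]
  have hadj : S.A.charmatrix.adjugate.map φ = (algebraMap ℂ _ s - toC S.A).adjugate := by
    have := φ.map_adjugate S.A.charmatrix
    rw [RingHom.mapMatrix_apply, RingHom.mapMatrix_apply, hchar] at this
    exact this
  have hne : φ S.A.charpoly ≠ 0 := by
    rw [hdet]
    exact ((Matrix.isUnit_iff_isUnit_det _).mp (hA.mem_resolventSet hs)).ne_zero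
  have hres : cRes S.A s = (φ S.A.charpoly)⁻¹ • S.A.charmatrix.adjugate.map φ := by
    rw [cRes, resolvent, ← Matrix.nonsing_inv_eq_ringInverse, Matrix.inv_def, hdet, hadj,
      Ring.inverse_eq_inv]
  set P : Matrix (Fin m) (Fin p) (Polynomial ℝ) :=
    S.C.map Polynomial.C * S.A.charmatrix.adjugate * S.B.map Polynomial.C
      + S.A.charpoly • S.D.map Polynomial.C with hP
  have hratres : algebraMap (Polynomial ℝ) (RatFunc ℝ) S.A.charpoly • ratResolvent S.A =
      S.A.charmatrix.adjugate.map (algebraMap (Polynomial ℝ) (RatFunc ℝ)) := by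
    have h1 := (algebraMap (Polynomial ℝ) (RatFunc ℝ)).map_adjugate S.A.charmatrix
    have h2 := (algebraMap (Polynomial ℝ) (RatFunc ℝ)).map_det S.A.charmatrix
    rw [RingHom.mapMatrix_apply, RingHom.mapMatrix_apply, charmatrix_map_ratFunc] at h1
    rw [RingHom.mapMatrix_apply, charmatrix_map_ratFunc] at h2
    rw [h1, Matrix.charpoly, h2, ratResolvent, Matrix.inv_def, smul_smul,
      Ring.mul_inverse_cancel _ (isUnit_det_ratFunc S.A), one_smul]
  have hGP : algebraMap (Polynomial ℝ) (RatFunc ℝ) S.A.charpoly • S.transfer =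
      P.map (algebraMap (Polynomial ℝ) (RatFunc ℝ)) := by
    rw [transfer_eq, smul_add, ← Matrix.smul_mul, ← Matrix.mul_smul, hratres, hP]
    ext1 i j
    simp [Matrix.mul_apply, Algebra.smul_def]
  ext1 i j
  have h1 : (S.transfer i j).num * S.A.charpoly = P i j * (S.transfer i j).denom := by
    apply RatFunc.algebraMap_injective ℝ
    have h2 := congrFun (congrFun hGP i) j
    rw [Matrix.smul_apply, smul_eq_mul, Matrix.map_apply] at h2
    have hden : algebraMap (Polynomial ℝ) (RatFunc ℝ) (S.transfer i j).denom ≠ 0 :=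
      RatFunc.algebraMap_ne_zero (RatFunc.denom_ne_zero _)
    have hnum : algebraMap (Polynomial ℝ) (RatFunc ℝ) (S.transfer i j).num =
        S.transfer i j * algebraMap (Polynomial ℝ) (RatFunc ℝ) (S.transfer i j).denom := by
      rw [← div_eq_iff hden, RatFunc.num_div_denom]
    rw [map_mul, map_mul, ← h2, hnum]
    ring
  have h3 := congrArg φ h1
  rw [map_mul, map_mul] at h3
  have hden : φ (S.transfer i j).denom ≠ 0 := fun h =>
    absurd ((hS i j).2 s h) (not_lt.mpr hs)
  have h4 : evalAt S.transfer s i j = φ (P i j) / φ S.A.charpoly := by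
    rw [eq_div_iff hne]
    change φ (S.transfer i j).num / φ (S.transfer i j).denom * _ = _
    rw [div_mul_eq_mul_div, h3, mul_div_cancel_right₀ _ hden]
  rw [h4, hres, hP, div_eq_iff hne]
  simp only [Matrix.add_apply, map_add, add_mul]
  congr 1
  · simp only [Matrix.mul_smul, Matrix.smul_mul, Matrix.smul_apply, smul_eq_mul]
    rw [mul_comm (φ S.A.charpoly)⁻¹, inv_mul_cancel_right₀ hne]
    simp [Matrix.mul_apply, toC, hφ, Polynomial.eval₂_finsetSum]
  · simp [toC, hφ, mul_comm]

end Evaluation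

/-! ### Contour integration in the right half-plane. -/

section HalfPlane

open Filter Topology

theorem integrable_of_norm_le_inv_sq {f : ℝ → ℂ} (hf : Continuous f) {M : ℝ}
    (hM : ∀ ω, ‖f ω‖ ≤ M / (1 + |ω|) ^ 2) : Integrable f := by
  refine Integrable.mono' (integrable_inv_one_add_sq.const_mul |M|) hf.aestronglyMeasurable
    (Eventually.of_forall fun ω => (hM ω).trans ?_)
  rw [← div_eq_mul_inv]
  have h1 : 1 + ω ^ 2 ≤ (1 + |ω|) ^ 2 := by
    nlinarith [abs_nonneg ω, sq_abs ω]
  have h2 : 0 < 1 + ω ^ 2 := by positivity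
  exact div_le_div₀ (abs_nonneg _) (le_abs_self M) h2 h1

theorem continuous_comp_mul_I {f : ℂ → ℂ} (hf : ∀ s : ℂ, 0 ≤ s.re → DifferentiableAt ℂ f s) :
    Continuous fun ω : ℝ => f (ω * Complex.I) := by
  rw [continuous_iff_continuousAt]
  intro ω
  have h1 : ContinuousAt f ((ω : ℂ) * Complex.I) := (hf _ (by simp)).continuousAt
  exact ContinuousAt.comp (f := fun ω : ℝ => (ω : ℂ) * Complex.I) h1
    (by fun_prop : Continuous fun ω : ℝ => (ω : ℂ) * Complex.I).continuousAt

/-- Cauchy's theorem for the right half-plane. -/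
theorem integral_imaginary_axis_eq_zero {f : ℂ → ℂ} {M : ℝ}
    (hf : ∀ s : ℂ, 0 ≤ s.re → DifferentiableAt ℂ f s)
    (hM : ∀ s : ℂ, 0 ≤ s.re → ‖f s‖ ≤ M / (1 + ‖s‖) ^ 2) :
    Integrable (fun ω : ℝ => f (ω * Complex.I)) ∧ ∫ ω : ℝ, f (ω * Complex.I) = 0 := by
  have hint : Integrable (fun ω : ℝ => f (ω * Complex.I)) := by
    refine integrable_of_norm_le_inv_sq (continuous_comp_mul_I hf) (M := M) fun ω => ?_
    simpa using hM (ω * Complex.I) (by simp)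
  refine ⟨hint, ?_⟩
  have hM0 : 0 ≤ M := by
    have := (norm_nonneg _).trans (hM 0 (by simp))
    simpa using this
  have hlim := intervalIntegral_tendsto_integral hint tendsto_neg_atTop_atBot tendsto_id
  refine tendsto_nhds_unique hlim ?_
  rw [tendsto_zero_iff_norm_tendsto_zero]
  have hb : Tendsto (fun T : ℝ => 4 * M * T⁻¹) atTop (𝓝 0) := by
    simpa using tendsto_inv_atTop_zero.const_mul (4 * M)
  refine tendsto_of_tendsto_of_tendsto_of_le_of_le' tendsto_const_nhds hb
    (Eventually.of_forall fun T => norm_nonneg _) ?_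
  filter_upwards [eventually_gt_atTop 0] with T hT
  -- On the rectangle `[0,T] × [-T,T]` the three sides off the imaginary axis have total length
  -- `4T`, and there `f` is at most `M/(1+T)²`; their contribution is `O(1/T)`.
  have hrect := Complex.integral_boundary_rect_eq_zero_of_differentiableOn f
    (-T * Complex.I) (T + T * Complex.I) (by
      intro s hs
      rw [Complex.mem_reProdIm] at hs
      refine (hf s ?_).differentiableWithinAt
      have := hs.1
      simp [Set.uIcc_of_le hT.le] at this
      exact this.1)
  simp only [Complex.mul_re, Complex.neg_re, Complex.ofReal_re, Complex.I_re, mul_zero,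
    Complex.neg_im, Complex.ofReal_im, Complex.I_im, mul_one, sub_self, neg_zero,
    Complex.mul_im, add_zero, Complex.add_re, Complex.add_im, zero_add, Complex.ofReal_neg,
    Complex.ofReal_zero, smul_eq_mul] at hrect
  have hle : ∀ s : ℂ, 0 ≤ s.re → T ≤ ‖s‖ → ‖f s‖ ≤ M / (1 + T) ^ 2 := fun s h1 h2 =>
    (hM s h1).trans (by gcongr)
  have e1 : ‖∫ x in (0 : ℝ)..T, f (x + -(T : ℂ) * Complex.I)‖ ≤ M / (1 + T) ^ 2 * |T - 0| := by
    refine intervalIntegral.norm_integral_le_of_norm_le_const fun x hx => ?_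
    rw [Set.uIoc_of_le hT.le] at hx
    refine hle _ (by simpa using hx.1.le) ?_
    refine le_trans ?_ (Complex.abs_im_le_norm _)
    simp [abs_of_pos hT]
  have e2 : ‖∫ x in (0 : ℝ)..T, f (x + (T : ℂ) * Complex.I)‖ ≤ M / (1 + T) ^ 2 * |T - 0| := by
    refine intervalIntegral.norm_integral_le_of_norm_le_const fun x hx => ?_
    rw [Set.uIoc_of_le hT.le] at hx
    refine hle _ (by simpa using hx.1.le) ?_
    refine le_trans ?_ (Complex.abs_im_le_norm _)
    simp [abs_of_pos hT]
  have e3 : ‖∫ y in -T..T, f (T + (y : ℂ) * Complex.I)‖ ≤ M / (1 + T) ^ 2 * |T - -T| := by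
    refine intervalIntegral.norm_integral_le_of_norm_le_const fun x hx => ?_
    refine hle _ (by simpa using hT.le) ?_
    refine le_trans ?_ (Complex.abs_re_le_norm _)
    simp [abs_of_pos hT]
  set a := ∫ x in (0 : ℝ)..T, f (x + -(T : ℂ) * Complex.I)
  set b := ∫ x in (0 : ℝ)..T, f (x + (T : ℂ) * Complex.I)
  set c := ∫ y in -T..T, f (T + (y : ℂ) * Complex.I)
  change ‖∫ y in -T..T, f (y * Complex.I)‖ ≤ _
  have hd : ‖∫ y in -T..T, f (y * Complex.I)‖ = ‖a - b + Complex.I * c‖ := by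
    rw [sub_eq_zero] at hrect
    rw [hrect, norm_mul, Complex.norm_I, one_mul]
  rw [hd]
  have hT2 : |T - -T| = 2 * T := by rw [abs_of_pos] <;> linarith
  rw [sub_zero, abs_of_pos hT] at e1 e2
  rw [hT2] at e3
  have h3 : ‖a - b + Complex.I * c‖ ≤ ‖a‖ + ‖b‖ + ‖c‖ := by
    refine (norm_add_le _ _).trans ?_
    rw [norm_mul, Complex.norm_I, one_mul]
    gcongr
    exact norm_sub_le _ _
  have h4 : M / (1 + T) ^ 2 * T ≤ M * T⁻¹ := by
    rw [div_mul_eq_mul_div, div_le_iff₀ (by positivity)]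
    have : M * T⁻¹ * (1 + T) ^ 2 = M * (T⁻¹ + 2 + T) := by field_simp; ring
    rw [this]
    have : 0 < T⁻¹ := by positivity
    gcongr
    linarith
  linarith

end HalfPlane

/-! ### Decay of the resolvent and its integrals along the imaginary axis. -/

section Resolvent

open Filter Topology
open scoped Matrix.Norms.L2Operator

variable {N : ℕ}

theorem IsHurwitz.differentiableAt_cRes {A : Matrix (Fin N) (Fin N) ℝ} (hA : IsHurwitz A) {s : ℂ}
    (hs : 0 ≤ s.re) : DifferentiableAt ℂ (cRes A) s :=
  (spectrum.hasDerivAt_resolvent_const_left (hA.mem_resolventSet hs)).differentiableAt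

/-- The resolvent is `O(1/|s|)` at infinity and continuous on the remaining compact half-disc. -/
theorem IsHurwitz.exists_norm_cRes_le {A : Matrix (Fin N) (Fin N) ℝ} (hA : IsHurwitz A) :
    ∃ M, 0 ≤ M ∧ ∀ s : ℂ, 0 ≤ s.re → ‖cRes A s‖ ≤ M / (1 + ‖s‖) := by
  obtain ⟨c, hc0, hc⟩ := (spectrum.resolvent_isBigO_inv (𝕜 := ℂ) (toC A)).exists_pos
  rw [Asymptotics.IsBigOWith, ← comap_norm_atTop, eventually_comap] at hc
  obtain ⟨r, hr⟩ := eventually_atTop.mp hc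
  have hK : IsCompact ({s : ℂ | 0 ≤ s.re} ∩ Metric.closedBall 0 (max r 1)) :=
    (isCompact_closedBall _ _).inter_left (isClosed_le continuous_const Complex.continuous_re)
  obtain ⟨B, hB⟩ := hK.exists_bound_of_continuousOn (f := fun s => (1 + ‖s‖) * ‖cRes A s‖) (by
    intro s hs
    have h := (hA.differentiableAt_cRes hs.1).continuousAt
    exact ((continuous_const.add continuous_norm).continuousAt.mul h.norm).continuousWithinAt)
  refine ⟨max B (2 * c), le_max_of_le_right (by positivity), fun s hs => ?_⟩
  have h1 : 0 < 1 + ‖s‖ := by positivity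
  rw [le_div_iff₀ h1, mul_comm]
  by_cases hsr : ‖s‖ ≤ max r 1
  · refine le_max_of_le_left ((le_abs_self _).trans (hB s ⟨hs, ?_⟩))
    simpa using hsr
  · rw [not_le] at hsr
    have h2 := hr ‖s‖ ((le_max_left _ _).trans hsr.le) s rfl
    have h3 : 1 ≤ ‖s‖ := (le_max_right _ _).trans hsr.le
    rw [norm_inv] at h2
    refine le_max_of_le_right ?_
    calc (1 + ‖s‖) * ‖cRes A s‖ ≤ (2 * ‖s‖) * (c * ‖s‖⁻¹) := by
          refine mul_le_mul (by linarith) h2 (norm_nonneg _) (by positivity)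
      _ = 2 * c := by field_simp

theorem exists_norm_apply_le (l : Matrix (Fin N) (Fin N) ℂ →ₗ[ℂ] ℂ) :
    ∃ K, 0 ≤ K ∧ ∀ M, ‖l M‖ ≤ K * ‖M‖ :=
  ⟨‖LinearMap.toContinuousLinearMap l‖, norm_nonneg _, fun M =>
    (LinearMap.toContinuousLinearMap l).le_opNorm M⟩

theorem differentiable_linear (l : Matrix (Fin N) (Fin N) ℂ →ₗ[ℂ] ℂ) : Differentiable ℂ l :=
  (LinearMap.toContinuousLinearMap l).differentiable

/-- Two resolvent factors give decay of order `|s|⁻²`, enough for Cauchy's theorem. This kills the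
cross term in the Gramian bound. -/
theorem IsHurwitz.integral_cRes_mul_cRes {A : Matrix (Fin N) (Fin N) ℝ} (hA : IsHurwitz A)
    (l : Matrix (Fin N) (Fin N) ℂ →ₗ[ℂ] ℂ) (Q : Matrix (Fin N) (Fin N) ℂ) :
    Integrable (fun ω : ℝ => l (cRes A (ω * Complex.I) * Q * cRes A (ω * Complex.I))) ∧
      ∫ ω : ℝ, l (cRes A (ω * Complex.I) * Q * cRes A (ω * Complex.I)) = 0 := by
  obtain ⟨M, hM0, hM⟩ := hA.exists_norm_cRes_le
  obtain ⟨K, hK0, hK⟩ := exists_norm_apply_le l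
  refine integral_imaginary_axis_eq_zero (f := fun s => l (cRes A s * Q * cRes A s))
    (M := K * (M * ‖Q‖ * M)) (fun s hs => ?_) (fun s hs => ?_)
  · have h := hA.differentiableAt_cRes hs
    exact (differentiable_linear l _).comp s ((h.mul_const Q).mul h)
  · refine (hK _).trans ?_
    have : ‖cRes A s * Q * cRes A s‖ ≤ M / (1 + ‖s‖) * ‖Q‖ * (M / (1 + ‖s‖)) := by
      refine (norm_mul_le _ _).trans ?_
      refine mul_le_mul ((norm_mul_le _ _).trans ?_) (hM s hs) (norm_nonneg _) (by positivity)
      exact mul_le_mul_of_nonneg_right (hM s hs) (norm_nonneg _)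
    refine (mul_le_mul_of_nonneg_left this hK0).trans_eq ?_
    field_simp

theorem one_add_norm_le_of_re_nonneg {s : ℂ} (hs : 0 ≤ s.re) : 1 + ‖s‖ ≤ 2 * ‖s + 1‖ := by
  have h1 : 1 ≤ ‖s + 1‖ := by
    refine le_trans ?_ (Complex.re_le_norm _)
    simpa using hs
  have h2 : ‖s‖ ≤ ‖s + 1‖ := by
    rw [Complex.norm_def, Complex.norm_def]
    apply Real.sqrt_le_sqrt
    simp only [Complex.normSq_apply, Complex.add_re, Complex.add_im, Complex.one_re,
      Complex.one_im]
    nlinarith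
  linarith

/-- Subtracting `(s+1)⁻¹I` removes the leading term at infinity, and the difference decays like
`|s|⁻²`. -/
theorem IsHurwitz.cRes_sub_inv {A : Matrix (Fin N) (Fin N) ℝ} (hA : IsHurwitz A) {s : ℂ}
    (hs : 0 ≤ s.re) :
    cRes A s - (s + 1)⁻¹ • (1 : Matrix (Fin N) (Fin N) ℂ) =
      (s + 1)⁻¹ • (cRes A s * (1 + toC A)) := by
  have h0 : s + 1 ≠ 0 := by
    intro h
    have := congrArg Complex.re h
    simp at this
    linarith
  have h1 := hA.cRes_mul_sub hs
  rw [mul_sub, Algebra.algebraMap_eq_smul_one, Matrix.mul_smul, Matrix.mul_one] at h1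
  have h2 : cRes A s * (1 + toC A) = (s + 1) • cRes A s - 1 := by
    rw [mul_add, Matrix.mul_one, add_smul, one_smul, ← h1]
    abel
  rw [h2, smul_sub, smul_smul, inv_mul_cancel₀ h0, one_smul]

/-- Cauchy's theorem disposes of the resolvent minus `(s+1)⁻¹I`. What remains is `c · Re(1+jω)⁻¹ =
c/(1+ω²)`, with integral `πc`. Only the real part is integrable in general. -/
theorem IsHurwitz.integral_cRes {A : Matrix (Fin N) (Fin N) ℝ} (hA : IsHurwitz A)
    (l : Matrix (Fin N) (Fin N) ℂ →ₗ[ℂ] ℂ) {c : ℝ} (hc : l 1 = c) :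
    Integrable (fun ω : ℝ => (l (cRes A (ω * Complex.I))).re) ∧
      ∫ ω : ℝ, (l (cRes A (ω * Complex.I))).re = Real.pi * c := by
  obtain ⟨M, hM0, hM⟩ := hA.exists_norm_cRes_le
  obtain ⟨K, hK0, hK⟩ := exists_norm_apply_le l
  have h := integral_imaginary_axis_eq_zero (f := fun s =>
      l ((s + 1)⁻¹ • (cRes A s * (1 + toC A)))) (M := K * (2 * M * ‖1 + toC A‖))
      (fun s hs => ?_) (fun s hs => ?_)
  · obtain ⟨hi, h0⟩ := h
    have hre : ∀ ω : ℝ, (l (cRes A (ω * Complex.I))).re =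
        (l (((ω : ℂ) * Complex.I + 1)⁻¹ • (cRes A (ω * Complex.I) * (1 + toC A)))).re
          + (1 + ω ^ 2)⁻¹ * c := by
      intro ω
      rw [← hA.cRes_sub_inv (by simp), map_sub, map_smul, hc, Complex.sub_re]
      have : ((((ω : ℂ) * Complex.I + 1)⁻¹ • (c : ℂ) : ℂ)).re = (1 + ω ^ 2)⁻¹ * c := by
        rw [smul_eq_mul, Complex.re_mul_ofReal, Complex.inv_re, Complex.normSq_apply]
        simp
        left
        ring
      rw [this]
      ring
    have hi2 : Integrable fun ω : ℝ => (1 + ω ^ 2)⁻¹ * c := integrable_inv_one_add_sq.mul_const c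
    have hi1 : Integrable fun ω : ℝ => (l (((ω : ℂ) * Complex.I + 1)⁻¹ •
        (cRes A (ω * Complex.I) * (1 + toC A)))).re := hi.re
    simp only [hre]
    refine ⟨hi1.add hi2, ?_⟩
    rw [integral_add hi1 hi2, integral_mul_const, integral_univ_inv_one_add_sq]
    have h1 := integral_re hi
    have h2 : ∫ ω : ℝ, (l (((ω : ℂ) * Complex.I + 1)⁻¹ •
        (cRes A (ω * Complex.I) * (1 + toC A)))).re = 0 := by
      refine h1.trans ?_
      rw [h0]
      simp
    rw [h2, zero_add]
  · have h := hA.differentiableAt_cRes hs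
    have h0 : s + 1 ≠ 0 := by
      intro h
      have := congrArg Complex.re h
      simp at this
      linarith
    refine (differentiable_linear l _).comp s ?_
    have h1 : DifferentiableAt ℂ (fun s : ℂ => (s + 1)⁻¹) s :=
      (differentiableAt_id.add_const (1 : ℂ)).inv h0
    exact h1.smul (h.mul_const (1 + toC A))
  · refine (hK _).trans ?_
    rw [mul_div_assoc]
    refine mul_le_mul_of_nonneg_left ?_ hK0
    rw [norm_smul, norm_inv]
    have h1 : ‖s + 1‖⁻¹ ≤ 2 / (1 + ‖s‖) := by
      have h2 := one_add_norm_le_of_re_nonneg hs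
      have h3 : 0 < 1 + ‖s‖ := by positivity
      rw [inv_le_comm₀ (by linarith) (by positivity), inv_div]
      linarith
    calc ‖s + 1‖⁻¹ * ‖cRes A s * (1 + toC A)‖
        ≤ 2 / (1 + ‖s‖) * (M / (1 + ‖s‖) * ‖1 + toC A‖) := by
          refine mul_le_mul h1 ((norm_mul_le _ _).trans ?_) (norm_nonneg _) (by positivity)
          exact mul_le_mul_of_nonneg_right (hM s hs) (norm_nonneg _)
      _ = _ := by field_simp

end Resolvent

/-! ### Bilinear pairings with real vectors and squared norms. -/

section Pairing

variable {a b c : ℕ}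

/-- A real vector viewed as a complex one. -/
def cv (x : Fin a → ℝ) : Fin a → ℂ := fun i => (x i : ℂ)

/-- The squared Euclidean norm of a complex vector. -/
noncomputable def nsq (v : Fin a → ℂ) : ℝ := ∑ i, ‖v i‖ ^ 2

theorem nsq_nonneg (v : Fin a → ℂ) : 0 ≤ nsq v := Finset.sum_nonneg fun _ _ => sq_nonneg _

/-- The linear functional `M ↦ xᵀ M y`. -/
noncomputable def bil (x : Fin a → ℝ) (y : Fin b → ℝ) : Matrix (Fin a) (Fin b) ℂ →ₗ[ℂ] ℂ where
  toFun M := cv x ⬝ᵥ M *ᵥ cv y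
  map_add' M M' := by rw [Matrix.add_mulVec, dotProduct_add]
  map_smul' s M := by rw [Matrix.smul_mulVec, dotProduct_smul]; rfl

theorem bil_apply (x : Fin a → ℝ) (y : Fin b → ℝ) (M : Matrix (Fin a) (Fin b) ℂ) :
    bil x y M = cv x ⬝ᵥ M *ᵥ cv y := rfl

theorem star_cv (x : Fin a → ℝ) : star (cv x) = cv x := by
  ext i
  simp [cv]

theorem cv_mulVec (W : Matrix (Fin a) (Fin b) ℝ) (y : Fin b → ℝ) :
    cv (W *ᵥ y) = toC W *ᵥ cv y := by
  ext i
  simp [cv, toC, Matrix.mulVec, dotProduct]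

theorem bil_conjTranspose (x : Fin a → ℝ) (y : Fin b → ℝ) (M : Matrix (Fin a) (Fin b) ℂ) :
    bil y x Mᴴ = star (bil x y M) := by
  rw [bil_apply, bil_apply, ← Matrix.star_dotProduct_star, Matrix.star_mulVec, star_cv, star_cv,
    ← Matrix.dotProduct_mulVec]

theorem re_bil_conjTranspose (x : Fin a → ℝ) (y : Fin b → ℝ) (M : Matrix (Fin a) (Fin b) ℂ) :
    (bil y x Mᴴ).re = (bil x y M).re := by
  rw [bil_conjTranspose]
  exact Complex.conj_re _

theorem bil_mul_toC (x : Fin a → ℝ) (y : Fin c → ℝ) (M : Matrix (Fin a) (Fin b) ℂ)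
    (W : Matrix (Fin b) (Fin c) ℝ) : bil x y (M * toC W) = bil x (W *ᵥ y) M := by
  rw [bil_apply, bil_apply, cv_mulVec, Matrix.mulVec_mulVec]

theorem bil_toC_mul (x : Fin a → ℝ) (y : Fin c → ℝ) (W : Matrix (Fin a) (Fin b) ℝ)
    (M : Matrix (Fin b) (Fin c) ℂ) : bil x y (toC W * M) = bil (Wᵀ *ᵥ x) y M := by
  rw [bil_apply, bil_apply, cv_mulVec, ← Matrix.mulVec_mulVec, Matrix.dotProduct_mulVec,
    toC_transpose, Matrix.mulVec_transpose]

theorem bil_one (x y : Fin a → ℝ) : bil x y 1 = ((x ⬝ᵥ y : ℝ) : ℂ) := by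
  rw [bil_apply, Matrix.one_mulVec]
  simp [cv, dotProduct]

theorem nsq_eq_star_dotProduct (v : Fin a → ℂ) : (nsq v : ℂ) = star v ⬝ᵥ v := by
  simp [nsq, dotProduct, Complex.conj_mul']

theorem star_mulVec_dotProduct_mulVec (K L : Matrix (Fin b) (Fin a) ℂ) (y : Fin a → ℝ) :
    star (K *ᵥ cv y) ⬝ᵥ (L *ᵥ cv y) = bil y y (Kᴴ * L) := by
  rw [bil_apply, Matrix.star_mulVec, star_cv, ← Matrix.dotProduct_mulVec, Matrix.mulVec_mulVec]

theorem nsq_mulVec (K : Matrix (Fin b) (Fin a) ℂ) (y : Fin a → ℝ) :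
    nsq (K *ᵥ cv y) = (bil y y (Kᴴ * K)).re := by
  rw [← star_mulVec_dotProduct_mulVec, ← nsq_eq_star_dotProduct, Complex.ofReal_re]

theorem nsq_add_mulVec (K L : Matrix (Fin b) (Fin a) ℂ) (y : Fin a → ℝ) :
    nsq ((K + L) *ᵥ cv y) =
      nsq (K *ᵥ cv y) + nsq (L *ᵥ cv y) + 2 * (bil y y (Kᴴ * L)).re := by
  simp only [nsq_mulVec]
  rw [Matrix.conjTranspose_add, Matrix.add_mul, Matrix.mul_add, Matrix.mul_add, map_add, map_add,
    map_add, Complex.add_re, Complex.add_re, Complex.add_re]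
  have : (bil y y (Lᴴ * K)).re = (bil y y (Kᴴ * L)).re := by
    rw [← re_bil_conjTranspose, Matrix.conjTranspose_mul, Matrix.conjTranspose_conjTranspose]
  rw [this]
  ring

end Pairing

/-! ### Lyapunov equations and the bound on the observability Gramian. -/

section Lyapunov

variable {N m p : ℕ}

theorem aeval_transpose (A : Matrix (Fin N) (Fin N) ℝ) (q : Polynomial ℝ) :
    Polynomial.aeval Aᵀ q = (Polynomial.aeval A q)ᵀ := by
  induction q using Polynomial.induction_on' with
  | add q r hq hr => rw [map_add, map_add, hq, hr, Matrix.transpose_add]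
  | monomial n a =>
    rw [Polynomial.aeval_monomial, Polynomial.aeval_monomial, ← Matrix.transpose_pow,
      Matrix.transpose_mul, Algebra.algebraMap_eq_smul_one]
    simp

theorem IsHurwitz.transpose {A : Matrix (Fin N) (Fin N) ℝ} (hA : IsHurwitz A) : IsHurwitz Aᵀ := by
  obtain ⟨q, hq, hroot⟩ := hA
  exact ⟨q, by rw [aeval_transpose, hq, Matrix.transpose_zero], hroot⟩

/-- On the imaginary axis `E = sI - A` has `Eᴴ = -sI - Aᵀ`, so the Lyapunov equation reads `Q = E W
+ W Eᴴ`; multiply by the resolvent and its adjoint. -/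
theorem IsHurwitz.cRes_lyapunov {A W Q : Matrix (Fin N) (Fin N) ℝ} (hA : IsHurwitz A)
    (h : A * W + W * Aᵀ = -Q) (ω : ℝ) :
    cRes A (ω * Complex.I) * toC Q * (cRes A (ω * Complex.I))ᴴ =
      cRes A (ω * Complex.I) * toC W + toC W * (cRes A (ω * Complex.I))ᴴ := by
  have hs : (0 : ℝ) ≤ ((ω : ℂ) * Complex.I).re := by simp
  set R := cRes A (ω * Complex.I) with hR
  set E := algebraMap ℂ (Matrix (Fin N) (Fin N) ℂ) (ω * Complex.I) - toC A with hE
  have h1 : R * E = 1 := hA.cRes_mul_sub hs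
  have h2 : Eᴴ * Rᴴ = 1 := by
    rw [← Matrix.conjTranspose_mul, h1, Matrix.conjTranspose_one]
  have hEH : Eᴴ = -algebraMap ℂ (Matrix (Fin N) (Fin N) ℂ) (ω * Complex.I) - toC Aᵀ := by
    rw [hE, Matrix.conjTranspose_sub, toC_conjTranspose, Algebra.algebraMap_eq_smul_one,
      Matrix.conjTranspose_smul, Matrix.conjTranspose_one]
    simp
  have h3 : toC Q = E * toC W + toC W * Eᴴ := by
    have h4 : toC Q = -(toC A * toC W + toC W * toC Aᵀ) := by
      rw [← toC_mul, ← toC_mul, ← toC_add, h, toC_neg, neg_neg]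
    rw [h4, hEH, hE, sub_mul, mul_sub, mul_neg, Algebra.commutes (R := ℂ)]
    abel
  rw [h3, mul_add, add_mul, ← mul_assoc R E, h1, one_mul, mul_assoc R, mul_assoc (toC W), h2,
    mul_one, add_comm]

theorem IsHurwitz.cRes_lyapunov_dual {A V Q : Matrix (Fin N) (Fin N) ℝ} (hA : IsHurwitz A)
    (h : Aᵀ * V + V * A = -Q) (ω : ℝ) :
    (cRes A (ω * Complex.I))ᴴ * toC Q * cRes A (ω * Complex.I) =
      (cRes A (ω * Complex.I))ᴴ * toC V + toC V * cRes A (ω * Complex.I) := by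
  have hs : (0 : ℝ) ≤ ((ω : ℂ) * Complex.I).re := by simp
  set R := cRes A (ω * Complex.I) with hR
  set E := algebraMap ℂ (Matrix (Fin N) (Fin N) ℂ) (ω * Complex.I) - toC A with hE
  have h1 : E * R = 1 := hA.sub_mul_cRes hs
  have h2 : Rᴴ * Eᴴ = 1 := by
    rw [← Matrix.conjTranspose_mul, h1, Matrix.conjTranspose_one]
  have hEH : Eᴴ = -algebraMap ℂ (Matrix (Fin N) (Fin N) ℂ) (ω * Complex.I) - toC Aᵀ := by
    rw [hE, Matrix.conjTranspose_sub, toC_conjTranspose, Algebra.algebraMap_eq_smul_one,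
      Matrix.conjTranspose_smul, Matrix.conjTranspose_one]
    simp
  have h3 : toC Q = Eᴴ * toC V + toC V * E := by
    have h4 : toC Q = -(toC Aᵀ * toC V + toC V * toC A) := by
      rw [← toC_mul, ← toC_mul, ← toC_add, h, toC_neg, neg_neg]
    rw [h4, hEH, hE, sub_mul, mul_sub, neg_mul, Algebra.commutes (R := ℂ)]
    abel
  rw [h3, mul_add, add_mul, ← mul_assoc Rᴴ Eᴴ, h2, one_mul, mul_assoc Rᴴ, mul_assoc (toC V), h1,
    mul_one, add_comm]

theorem IsHurwitz.integral_bil {A : Matrix (Fin N) (Fin N) ℝ} (hA : IsHurwitz A)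
    (x y : Fin N → ℝ) :
    Integrable (fun ω : ℝ => (bil x y (cRes A (ω * Complex.I))).re) ∧
      ∫ ω : ℝ, (bil x y (cRes A (ω * Complex.I))).re = Real.pi * (x ⬝ᵥ y) :=
  hA.integral_cRes (bil x y) (bil_one x y)

theorem IsHurwitz.nsq_lyapunov {A W : Matrix (Fin N) (Fin N) ℝ} {B : Matrix (Fin N) (Fin p) ℝ}
    (hA : IsHurwitz A) (hW : Wᵀ = W) (h : A * W + W * Aᵀ = -(B * Bᵀ)) (x : Fin N → ℝ) (ω : ℝ) :
    nsq ((toC Bᵀ * (cRes A (ω * Complex.I))ᴴ) *ᵥ cv x) =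
      2 * (bil x (W *ᵥ x) (cRes A (ω * Complex.I))).re := by
  rw [nsq_mulVec, Matrix.conjTranspose_mul, Matrix.conjTranspose_conjTranspose, toC_conjTranspose,
    Matrix.transpose_transpose, Matrix.mul_assoc, ← Matrix.mul_assoc (toC B), ← toC_mul,
    ← Matrix.mul_assoc, hA.cRes_lyapunov h, map_add, Complex.add_re, bil_mul_toC]
  have : (bil x x (toC W * (cRes A (ω * Complex.I))ᴴ)).re =
      (bil x (W *ᵥ x) (cRes A (ω * Complex.I))).re := by
    rw [← re_bil_conjTranspose, Matrix.conjTranspose_mul, Matrix.conjTranspose_conjTranspose,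
      toC_conjTranspose, bil_mul_toC, hW]
  rw [this]
  ring

/-- Integrating `nsq_lyapunov` over `ω` shows `2π xᵀWx` to be the integral of a squared norm. -/
theorem IsHurwitz.lyapunov_nonneg {A W : Matrix (Fin N) (Fin N) ℝ} {B : Matrix (Fin N) (Fin p) ℝ}
    (hA : IsHurwitz A) (hW : Wᵀ = W) (h : A * W + W * Aᵀ = -(B * Bᵀ)) (x : Fin N → ℝ) :
    0 ≤ x ⬝ᵥ W *ᵥ x := by
  have h1 := (hA.integral_bil x (W *ᵥ x)).2
  have h2 : 0 ≤ ∫ ω : ℝ, (bil x (W *ᵥ x) (cRes A (ω * Complex.I))).re := by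
    refine integral_nonneg fun ω => ?_
    have := hA.nsq_lyapunov hW h x ω
    have h0 := nsq_nonneg ((toC Bᵀ * (cRes A (ω * Complex.I))ᴴ) *ᵥ cv x)
    change 0 ≤ (bil x (W *ᵥ x) (cRes A (ω * Complex.I))).re
    linarith
  rw [h1] at h2
  exact nonneg_of_mul_nonneg_right h2 Real.pi_pos

theorem mulVec_eq_zero_of_dotProduct_eq_zero {W : Matrix (Fin N) (Fin N) ℝ} (hW : Wᵀ = W)
    (hnn : ∀ x, 0 ≤ x ⬝ᵥ W *ᵥ x) {x : Fin N → ℝ} (hx : x ⬝ᵥ W *ᵥ x = 0) : W *ᵥ x = 0 := by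
  have hp : W.PosSemidef := Matrix.PosSemidef.of_dotProduct_mulVec_nonneg
    (by rw [Matrix.IsHermitian, Matrix.conjTranspose_eq_transpose_of_trivial, hW])
    (fun x => by simpa using hnn x)
  exact (hp.dotProduct_mulVec_zero_iff x).mp (by simpa using hx)

/-- With `Q = 0`, both `W` and `-W` are positive semidefinite. -/
theorem IsHurwitz.lyapunov_eq_zero {A W : Matrix (Fin N) (Fin N) ℝ}
    (hA : IsHurwitz A) (hW : Wᵀ = W) (h : A * W + W * Aᵀ = 0) : W = 0 := by
  have h1 : ∀ x : Fin N → ℝ, 0 ≤ x ⬝ᵥ W *ᵥ x :=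
    hA.lyapunov_nonneg (B := (0 : Matrix (Fin N) (Fin N) ℝ)) hW (by simpa using h)
  have h2 : ∀ x : Fin N → ℝ, 0 ≤ x ⬝ᵥ (-W) *ᵥ x :=
    hA.lyapunov_nonneg (B := (0 : Matrix (Fin N) (Fin N) ℝ)) (by rw [Matrix.transpose_neg, hW])
      (by rw [Matrix.mul_neg, Matrix.neg_mul, ← neg_add, h]; simp)
  refine Matrix.ext_of_mulVec_single fun i => ?_
  rw [Matrix.zero_mulVec]
  refine mulVec_eq_zero_of_dotProduct_eq_zero hW h1 (le_antisymm ?_ (h1 _))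
  have := h2 (Pi.single i 1)
  rw [Matrix.neg_mulVec, dotProduct_neg] at this
  linarith

/-- The Lyapunov equation `A W + W Aᵀ = -Q` of a Hurwitz matrix has a symmetric solution. -/
theorem IsHurwitz.exists_lyapunov {A : Matrix (Fin N) (Fin N) ℝ} (hA : IsHurwitz A)
    (Q : Matrix (Fin N) (Fin N) ℝ) (hQ : Qᵀ = Q) :
    ∃ W : Matrix (Fin N) (Fin N) ℝ, Wᵀ = W ∧ A * W + W * Aᵀ = -Q := by
  -- The Lyapunov operator acts through the symmetric part and the last summand detects the
  -- antisymmetric part. Uniqueness among symmetric matrices thus makes `f` injective on all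
  -- matrices, hence surjective.
  let f : Matrix (Fin N) (Fin N) ℝ →ₗ[ℝ] Matrix (Fin N) (Fin N) ℝ :=
    { toFun := fun X => A * (X + Xᵀ) + (X + Xᵀ) * Aᵀ + (X - Xᵀ)
      map_add' := fun X Y => by
        simp only [Matrix.transpose_add, Matrix.mul_add, Matrix.add_mul]; abel
      map_smul' := fun c X => by
        simp only [Matrix.transpose_smul, ← smul_add, ← smul_sub, Matrix.mul_smul,
          Matrix.smul_mul, RingHom.id_apply] }
  have key : ∀ X Z : Matrix (Fin N) (Fin N) ℝ, Zᵀ = Z → f X = Z →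
      A * (X + Xᵀ) + (X + Xᵀ) * Aᵀ = Z ∧ X = Xᵀ := by
    intro X Z hZ hX
    have h1 : A * (X + Xᵀ) + (X + Xᵀ) * Aᵀ + (X - Xᵀ) = Z := hX
    have h2 := congrArg Matrix.transpose h1
    rw [hZ, Matrix.transpose_add, Matrix.transpose_add, Matrix.transpose_mul, Matrix.transpose_mul,
      Matrix.transpose_sub, Matrix.transpose_transpose, Matrix.transpose_add,
      Matrix.transpose_transpose, add_comm Xᵀ X, add_comm ((X + Xᵀ) * Aᵀ)] at h2
    have h3 : X = Xᵀ := by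
      have h4 := h1.trans h2.symm
      rw [add_right_inj] at h4
      ext i j
      have := congrFun (congrFun h4 i) j
      simp only [Matrix.sub_apply] at this
      linarith
    refine ⟨?_, h3⟩
    rw [← h3, sub_self, add_zero] at h1
    rwa [← h3]
  have hinj : Function.Injective f := by
    rw [injective_iff_map_eq_zero]
    intro X hX
    obtain ⟨h1, h2⟩ := key X 0 Matrix.transpose_zero hX
    have h3 := hA.lyapunov_eq_zero (by
      rw [Matrix.transpose_add, Matrix.transpose_transpose, add_comm]) h1
    rw [← h2] at h3
    ext i j
    have := congrFun (congrFun h3 i) j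
    simp only [Matrix.add_apply, Matrix.zero_apply] at this ⊢
    linarith
  obtain ⟨X, hX⟩ := (LinearMap.injective_iff_surjective.mp hinj) (-Q)
  refine ⟨X + Xᵀ, ?_, (key X (-Q) (by rw [Matrix.transpose_neg, hQ]) hX).1⟩
  rw [Matrix.transpose_add, Matrix.transpose_transpose, add_comm]

/-- The Hankel operator of an input-normal system is bounded by the `H∞` norm: the observability
Gramian is at most `γ²`. -/
theorem gramian_le_of_hinf_le (S : StateSpace N m p) (hA : IsHurwitz S.A)
    (hW : S.A + S.Aᵀ = -(S.B * S.Bᵀ)) {V : Matrix (Fin N) (Fin N) ℝ} (hVs : Vᵀ = V)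
    (hV : S.Aᵀ * V + V * S.A = -(S.Cᵀ * S.C)) {γ : ℝ}
    (hγ : ∀ (ω : ℝ) (v : Fin p → ℂ),
      nsq ((toC S.C * cRes S.A (ω * Complex.I) * toC S.B + toC S.D) *ᵥ v) ≤ γ ^ 2 * nsq v)
    (z : Fin N → ℝ) : z ⬝ᵥ V *ᵥ z ≤ γ ^ 2 * (z ⬝ᵥ z) := by
  -- Since `R B Bᵀ Rᴴ = R + Rᴴ`, the frequency response sends the input `Bᵀ Rᴴ z` to `C R z + E Rᴴ
  -- z`. In time these are a past input steering the state to `z`, the future output from `z`, and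
  -- the past output.
  set E := S.C + S.D * S.Bᵀ with hE
  have hW1 : S.A * 1 + 1 * S.Aᵀ = -(S.B * S.Bᵀ) := by rw [mul_one, one_mul, hW]
  have hpt : ∀ ω : ℝ, (bil (V *ᵥ z) z (cRes S.A (ω * Complex.I))).re
      + (bil z z (cRes S.A (ω * Complex.I) * toC (Eᵀ * S.C) * cRes S.A (ω * Complex.I))).re
      ≤ γ ^ 2 * (bil z z (cRes S.A (ω * Complex.I))).re := by
    intro ω
    set R := cRes S.A (ω * Complex.I) with hR
    have hin : nsq ((toC S.Bᵀ * Rᴴ) *ᵥ cv z) = 2 * (bil z z R).re := by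
      have := hA.nsq_lyapunov (Matrix.transpose_one) hW1 z ω
      rwa [Matrix.one_mulVec] at this
    have hid : (toC S.C * R * toC S.B + toC S.D) * (toC S.Bᵀ * Rᴴ) =
        toC S.C * R + toC E * Rᴴ := by
      have h1 := hA.cRes_lyapunov hW1 ω
      rw [toC_one, Matrix.mul_one, Matrix.one_mul, toC_mul, ← hR] at h1
      calc (toC S.C * R * toC S.B + toC S.D) * (toC S.Bᵀ * Rᴴ)
          = toC S.C * (R * (toC S.B * toC S.Bᵀ) * Rᴴ) + toC S.D * toC S.Bᵀ * Rᴴ := by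
            simp only [Matrix.add_mul, Matrix.mul_assoc]
        _ = _ := by
            rw [h1, hE, toC_add, toC_mul, Matrix.mul_add, Matrix.add_mul, add_assoc]
    have hout : nsq ((toC S.C * R) *ᵥ cv z) = 2 * (bil (V *ᵥ z) z R).re := by
      rw [nsq_mulVec, Matrix.conjTranspose_mul, toC_conjTranspose, Matrix.mul_assoc,
        ← Matrix.mul_assoc (toC S.Cᵀ), ← toC_mul, ← Matrix.mul_assoc, hR,
        hA.cRes_lyapunov_dual hV, ← hR, map_add, Complex.add_re, bil_toC_mul, hVs]
      have : (bil z z (Rᴴ * toC V)).re = (bil (V *ᵥ z) z R).re := by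
        rw [← re_bil_conjTranspose, Matrix.conjTranspose_mul, Matrix.conjTranspose_conjTranspose,
          toC_conjTranspose, bil_toC_mul, hVs, hVs]
      rw [this]
      ring
    -- The cross term is antianalytic; its adjoint `R Eᵀ C R` is analytic with the same real part,
    -- so it integrates to zero.
    have hcross : (bil z z ((toC S.C * R)ᴴ * (toC E * Rᴴ))).re =
        (bil z z (R * toC (Eᵀ * S.C) * R)).re := by
      rw [← re_bil_conjTranspose]
      congr 2
      simp only [Matrix.conjTranspose_mul, Matrix.conjTranspose_conjTranspose, toC_conjTranspose,
        toC_mul, Matrix.mul_assoc, Matrix.transpose_transpose]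
    have h := hγ ω ((toC S.Bᵀ * Rᴴ) *ᵥ cv z)
    rw [Matrix.mulVec_mulVec, hid, nsq_add_mulVec, hin, hout, hcross] at h
    -- The energy of the past output is discarded.
    have := nsq_nonneg ((toC E * Rᴴ) *ᵥ cv z)
    linarith
  obtain ⟨hi1, h1⟩ := hA.integral_bil (V *ᵥ z) z
  obtain ⟨hi2, h2⟩ := hA.integral_cRes_mul_cRes (bil z z) (toC (Eᵀ * S.C))
  obtain ⟨hi3, h3⟩ := hA.integral_bil z z
  have hi2' : Integrable fun ω : ℝ => (bil z z (cRes S.A (ω * Complex.I) * toC (Eᵀ * S.C) *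
      cRes S.A (ω * Complex.I))).re := hi2.re
  have h2' : ∫ ω : ℝ, (bil z z (cRes S.A (ω * Complex.I) * toC (Eᵀ * S.C) *
      cRes S.A (ω * Complex.I))).re = 0 := by
    refine (integral_re hi2).trans ?_
    rw [h2]
    simp
  have := integral_mono (hi1.add hi2') (hi3.const_mul (γ ^ 2)) hpt
  rw [integral_const_mul, h3, integral_add' hi1 hi2', h1, h2', add_zero, mul_left_comm] at this
  rw [dotProduct_comm]
  exact le_of_mul_le_mul_left this Real.pi_pos

end Lyapunov

/-! ### Coordinates in which the reachability Gramian is the identity. -/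

section InputNormal

variable {N N' m p : ℕ}

theorem intertwine_aeval {A : Matrix (Fin N) (Fin N) ℝ} {A' : Matrix (Fin N') (Fin N') ℝ}
    {T : Matrix (Fin N) (Fin N') ℝ} (h : T * A' = A * T) (q : Polynomial ℝ) :
    T * Polynomial.aeval A' q = Polynomial.aeval A q * T := by
  induction q using Polynomial.induction_on' with
  | add q r hq hr => rw [map_add, map_add, Matrix.mul_add, Matrix.add_mul, hq, hr]
  | monomial n a =>
    rw [Polynomial.aeval_monomial, Polynomial.aeval_monomial, ← Algebra.smul_def,
      ← Algebra.smul_def, Matrix.mul_smul, Matrix.smul_mul, intertwine_pow h]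

/-- The Lyapunov equation makes the kernel of `W` an `Aᵀ`-invariant subspace of the kernel of `Bᵀ`,
which is zero by reachability. -/
theorem isUnit_gramian_of_reachable {A W : Matrix (Fin N) (Fin N) ℝ} {B : Matrix (Fin N) (Fin p) ℝ}
    (hr : IsReachable A B) (hW : Wᵀ = W) (h : A * W + W * Aᵀ = -(B * Bᵀ)) : IsUnit W := by
  rw [← Matrix.mulVec_injective_iff_isUnit]
  have hstep : ∀ x : Fin N → ℝ, W *ᵥ x = 0 → Bᵀ *ᵥ x = 0 ∧ W *ᵥ (Aᵀ *ᵥ x) = 0 := by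
    intro x hx
    have h1 := congrArg (fun M => M *ᵥ x) h
    simp only [Matrix.add_mulVec, ← Matrix.mulVec_mulVec, hx, Matrix.mulVec_zero, zero_add,
      Matrix.neg_mulVec] at h1
    have h2 : Bᵀ *ᵥ x = 0 := by
      have h3 := congrArg (fun v => x ⬝ᵥ v) h1
      simp only [dotProduct_neg] at h3
      rw [Matrix.dotProduct_mulVec, ← Matrix.mulVec_transpose, hW, hx, zero_dotProduct,
        Matrix.dotProduct_mulVec, ← Matrix.mulVec_transpose, zero_eq_neg] at h3
      exact dotProduct_self_eq_zero.mp h3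
    refine ⟨h2, ?_⟩
    rw [h1, h2, Matrix.mulVec_zero, neg_zero]
  have hpow : ∀ (k : ℕ) (x : Fin N → ℝ), W *ᵥ x = 0 → W *ᵥ (Aᵀ ^ k *ᵥ x) = 0 := by
    intro k
    induction k with
    | zero => intro x hx; simpa using hx
    | succ k ih =>
      intro x hx
      rw [pow_succ, ← Matrix.mulVec_mulVec]
      exact ih _ (hstep x hx).2
  intro x y hxy
  rw [← sub_eq_zero]
  have h0 : W *ᵥ (x - y) = 0 := by rw [Matrix.mulVec_sub, hxy, sub_self]
  refine hr.isObservable_transpose _ fun k => ?_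
  rw [← Matrix.mulVec_mulVec]
  exact (hstep _ (hpow k _ h0)).1

open scoped MatrixOrder in
theorem exists_mul_transpose_eq {W : Matrix (Fin N) (Fin N) ℝ} (hW : Wᵀ = W)
    (hnn : ∀ x, 0 ≤ x ⬝ᵥ W *ᵥ x) : ∃ T : Matrix (Fin N) (Fin N) ℝ, W = T * Tᵀ := by
  have hp : W.PosSemidef := Matrix.PosSemidef.of_dotProduct_mulVec_nonneg
    (by rw [Matrix.IsHermitian, Matrix.conjTranspose_eq_transpose_of_trivial, hW])
    (fun x => by simpa using hnn x)
  obtain ⟨M, hM⟩ := CStarAlgebra.nonneg_iff_eq_star_mul_self.mp hp.nonneg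
  refine ⟨Mᵀ, ?_⟩
  rw [hM, Matrix.star_eq_conjTranspose, Matrix.conjTranspose_eq_transpose_of_trivial,
    Matrix.transpose_transpose]

/-- A Hurwitz reachable system is similar to one whose reachability Gramian is the identity. -/
theorem exists_inputNormal (S : StateSpace N m p) (hA : IsHurwitz S.A)
    (hr : IsReachable S.A S.B) :
    ∃ S' : StateSpace N m p, S'.transfer = S.transfer ∧ IsHurwitz S'.A ∧
      S'.A + S'.Aᵀ = -(S'.B * S'.Bᵀ) := by
  obtain ⟨W, hW, hL⟩ := hA.exists_lyapunov (S.B * S.Bᵀ)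
    (by rw [Matrix.transpose_mul, Matrix.transpose_transpose])
  have hu := isUnit_gramian_of_reachable hr hW hL
  obtain ⟨T, hT⟩ := exists_mul_transpose_eq hW (hA.lyapunov_nonneg hW hL)
  have hTu : IsUnit T.det := by
    rw [hT, Matrix.isUnit_iff_isUnit_det, Matrix.det_mul] at hu
    exact isUnit_of_mul_isUnit_left hu
  have hTi : T * T⁻¹ = 1 := Matrix.mul_nonsing_inv _ hTu
  have hiT : T⁻¹ * T = 1 := Matrix.nonsing_inv_mul _ hTu
  have hiTt : Tᵀ * (T⁻¹)ᵀ = 1 := by rw [← Matrix.transpose_mul, hiT, Matrix.transpose_one]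
  have hAT : T * (T⁻¹ * S.A * T) = S.A * T := by
    rw [Matrix.mul_assoc, ← Matrix.mul_assoc, hTi, Matrix.one_mul]
  refine ⟨⟨T⁻¹ * S.A * T, T⁻¹ * S.B, S.C * T, S.D⟩, ?_, ?_, ?_⟩
  · refine transfer_eq_of_intertwine S _ T hAT ?_ rfl rfl
    rw [← Matrix.mul_assoc, hTi, Matrix.one_mul]
  · obtain ⟨q, hq, hroot⟩ := hA
    refine ⟨q, ?_, hroot⟩
    have := intertwine_aeval hAT q
    rw [hq, Matrix.zero_mul] at this
    rw [← Matrix.one_mul (Polynomial.aeval (T⁻¹ * S.A * T) q), ← hiT, Matrix.mul_assoc, this,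
      Matrix.mul_zero]
  · have h1 : T⁻¹ * (S.A * (T * Tᵀ) + T * Tᵀ * S.Aᵀ) * (T⁻¹)ᵀ =
        T⁻¹ * S.A * T + (T⁻¹ * S.A * T)ᵀ := by
      rw [Matrix.mul_add, Matrix.add_mul, Matrix.transpose_mul, Matrix.transpose_mul]
      congr 1
      · rw [← Matrix.mul_assoc, ← Matrix.mul_assoc, Matrix.mul_assoc _ Tᵀ, hiTt, Matrix.mul_one]
      · rw [← Matrix.mul_assoc, ← Matrix.mul_assoc, hiT, Matrix.one_mul, Matrix.mul_assoc]
    change T⁻¹ * S.A * T + (T⁻¹ * S.A * T)ᵀ = -(T⁻¹ * S.B * (T⁻¹ * S.B)ᵀ)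
    rw [← h1, ← hT, hL, Matrix.transpose_mul]
    simp only [Matrix.mul_neg, Matrix.neg_mul, Matrix.mul_assoc]

/-- A stable transfer matrix has an input-normal Hurwitz realization whose dimension is at most
that of any given realization. -/
theorem exists_inputNormal_realization (S : StateSpace N m p) (hS : IsStable S.transfer) :
    ∃ (r : ℕ) (S' : StateSpace r m p), r ≤ N ∧ S'.transfer = S.transfer ∧ IsHurwitz S'.A ∧
      S'.A + S'.Aᵀ = -(S'.B * S'.Bᵀ) := by
  obtain ⟨r, S₁, hr, ht, hreach, hobs⟩ := exists_reachable_observable S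
  have hA := isHurwitz_of_reachable_observable S₁ (ht ▸ hS) hreach hobs
  obtain ⟨S₂, ht2, hA2, hn⟩ := exists_inputNormal S₁ hA hreach
  exact ⟨r, S₂, hr, ht2.trans ht, hA2, hn⟩

end InputNormal

/-! ### Energy integrals and the L¹ norm of the impulse response. -/

section Energy

variable {N m p : ℕ}

/-- The squared Frobenius norm. -/
def frob {a b : ℕ} (M : Matrix (Fin a) (Fin b) ℝ) : ℝ := ∑ i, ∑ j, M i j ^ 2

theorem frob_nonneg {a b : ℕ} (M : Matrix (Fin a) (Fin b) ℝ) : 0 ≤ frob M :=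
  Finset.sum_nonneg fun _ _ => Finset.sum_nonneg fun _ _ => sq_nonneg _

theorem frob_transpose {a b : ℕ} (M : Matrix (Fin a) (Fin b) ℝ) : frob Mᵀ = frob M :=
  Finset.sum_comm

theorem trace_transpose_mul_self_eq_frob {a b : ℕ} (M : Matrix (Fin a) (Fin b) ℝ) :
    (Mᵀ * M).trace = frob M := by
  rw [frob, Finset.sum_comm]
  simp [Matrix.trace, Matrix.mul_apply, sq]

theorem trace_transpose_mul_mul_nonneg {V : Matrix (Fin N) (Fin N) ℝ}
    (hV : ∀ x, 0 ≤ x ⬝ᵥ V *ᵥ x) (M : Matrix (Fin N) (Fin N) ℝ) : 0 ≤ (Mᵀ * V * M).trace := by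
  refine Finset.sum_nonneg fun k _ => ?_
  have := hV (fun i => M i k)
  rw [Matrix.diag_apply, Matrix.mul_assoc, Matrix.mul_apply]
  exact this

open scoped Matrix.Norms.L2Operator in
theorem hasDerivAt_trace_lyapunov {A V : Matrix (Fin N) (Fin N) ℝ} {C : Matrix (Fin m) (Fin N) ℝ}
    (h : Aᵀ * V + V * A = -(Cᵀ * C)) (t : ℝ) :
    HasDerivAt (fun t : ℝ =>
      ((NormedSpace.exp (t • A))ᵀ * V * NormedSpace.exp (t • A)).trace)
      (-frob (C * NormedSpace.exp (t • A))) t := by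
  have hE := hasDerivAt_exp_smul_const' (𝕂 := ℝ) A t
  have hEt := hasDerivAt_exp_smul_const (𝕂 := ℝ) Aᵀ t
  have htr : ∀ t : ℝ, (NormedSpace.exp (t • A))ᵀ = NormedSpace.exp (t • Aᵀ) := fun t => by
    rw [← Matrix.exp_transpose, Matrix.transpose_smul]
  have hprod := (hEt.mul_const V).mul hE
  have hT := (LinearMap.toContinuousLinearMap
    (Matrix.traceLinearMap (Fin N) ℝ ℝ)).hasFDerivAt.comp_hasDerivAt t hprod
  simp only [htr]
  refine HasDerivAt.congr_deriv (f := fun t : ℝ =>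
    (NormedSpace.exp (t • Aᵀ) * V * NormedSpace.exp (t • A)).trace) hT ?_
  change Matrix.trace (_ : Matrix (Fin N) (Fin N) ℝ) = _
  rw [← trace_transpose_mul_self_eq_frob, Matrix.transpose_mul, htr, ← Matrix.trace_neg]
  congr 1
  have h2 : NormedSpace.exp (t • Aᵀ) * (Aᵀ * V + V * A) * NormedSpace.exp (t • A) =
      NormedSpace.exp (t • Aᵀ) * (-(Cᵀ * C)) * NormedSpace.exp (t • A) := by rw [h]
  simp only [Matrix.mul_add, Matrix.add_mul, Matrix.mul_neg, Matrix.neg_mul,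
    Matrix.mul_assoc] at h2 ⊢
  exact h2

open scoped Matrix.Norms.L2Operator in
theorem continuous_exp_smul (A : Matrix (Fin N) (Fin N) ℝ) :
    Continuous fun t : ℝ => NormedSpace.exp (t • A) :=
  continuous_iff_continuousAt.mpr fun t =>
    (hasDerivAt_exp_smul_const (𝕂 := ℝ) A t).continuousAt

theorem continuous_frob {a b : ℕ} : Continuous (frob (a := a) (b := b)) := by
  unfold frob
  fun_prop

theorem continuous_frob_mul_exp (C : Matrix (Fin m) (Fin N) ℝ) (A : Matrix (Fin N) (Fin N) ℝ) :
    Continuous fun t : ℝ => frob (C * NormedSpace.exp (t • A)) :=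
  continuous_frob.comp (continuous_const.matrix_mul (continuous_exp_smul A))

/-- The trace of `e^{Aᵀt} V e^{At}` starts at `tr V`, stays nonnegative and decreases at rate `‖C
e^{At}‖²`. -/
theorem integral_frob_le_trace {A V : Matrix (Fin N) (Fin N) ℝ} {C : Matrix (Fin m) (Fin N) ℝ}
    (h : Aᵀ * V + V * A = -(Cᵀ * C)) (hV : ∀ x, 0 ≤ x ⬝ᵥ V *ᵥ x) (T : ℝ) :
    ∫ t in (0 : ℝ)..T, frob (C * NormedSpace.exp (t • A)) ≤ V.trace := by
  have h1 := intervalIntegral.integral_eq_sub_of_hasDerivAt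
    (fun t _ => (hasDerivAt_trace_lyapunov h t).neg)
    (((continuous_frob_mul_exp C A).neg.neg).intervalIntegrable 0 T)
  simp only [neg_neg, zero_smul, NormedSpace.exp_zero, Matrix.transpose_one, Matrix.one_mul,
    Matrix.mul_one, Pi.neg_apply] at h1
  rw [h1]
  have := trace_transpose_mul_mul_nonneg hV (NormedSpace.exp (T • A))
  linarith

theorem IsHurwitz.exists_gramian {A : Matrix (Fin N) (Fin N) ℝ} (hA : IsHurwitz A)
    (C : Matrix (Fin m) (Fin N) ℝ) :
    ∃ V : Matrix (Fin N) (Fin N) ℝ, Vᵀ = V ∧ Aᵀ * V + V * A = -(Cᵀ * C) ∧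
      ∀ x, 0 ≤ x ⬝ᵥ V *ᵥ x := by
  obtain ⟨V, hVs, hV⟩ := hA.transpose.exists_lyapunov (Cᵀ * C)
    (by rw [Matrix.transpose_mul, Matrix.transpose_transpose])
  refine ⟨V, hVs, by rwa [Matrix.transpose_transpose] at hV, ?_⟩
  exact hA.transpose.lyapunov_nonneg (B := Cᵀ) hVs (by rw [hV, Matrix.transpose_transpose])

theorem IsHurwitz.exists_frob_exp_lt {A : Matrix (Fin N) (Fin N) ℝ} (hA : IsHurwitz A) {ε : ℝ}
    (hε : 0 < ε) : ∃ T : ℝ, 0 < T ∧ frob (NormedSpace.exp (T • A)) < ε := by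
  obtain ⟨V, hVs, hV, hnn⟩ := hA.exists_gramian (1 : Matrix (Fin N) (Fin N) ℝ)
  by_contra! hcon
  -- Over this horizon an integrand staying at or above `ε` would accumulate `|tr V| + 1`, more than
  -- the energy `tr V` available.
  have hint := integral_frob_le_trace hV hnn ((|V.trace| + 1) / ε)
  have hc := continuous_frob_mul_exp (1 : Matrix (Fin N) (Fin N) ℝ) A
  simp only [Matrix.one_mul] at hint hc
  have hT : 0 ≤ (|V.trace| + 1) / ε := by positivity
  have h2 := intervalIntegral.integral_mono_on_of_le_Ioo hT
    (intervalIntegrable_const (μ := volume) (c := ε)) (hc.intervalIntegrable 0 _) (fun t ht => hcon t ht.1)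
  rw [intervalIntegral.integral_const, sub_zero, smul_eq_mul, div_mul_cancel₀ _ hε.ne'] at h2
  linarith [le_abs_self V.trace]

theorem sum_abs_le_sqrt_mul_sqrt {k : ℕ} (f : Fin k → ℝ) :
    ∑ j, |f j| ≤ √k * √(∑ j, f j ^ 2) := by
  rw [← Real.sqrt_mul (Nat.cast_nonneg k)]
  refine Real.le_sqrt_of_sq_le ?_
  have := Finset.sum_mul_sq_le_sq_mul_sq Finset.univ (fun _ : Fin k => (1 : ℝ)) (fun j => |f j|)
  simpa using this

/-- Cauchy–Schwarz over the `c` columns, then over the inner index, then the arithmetic-geometric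
mean. The weight `γ` balances energies of sizes `γ²` and 1. -/
theorem sum_abs_mul_le {a b c : ℕ} (M : Matrix (Fin a) (Fin b) ℝ) (L : Matrix (Fin b) (Fin c) ℝ)
    (i : Fin a) {γ : ℝ} (hγ : 0 < γ) :
    ∑ j, |(M * L) i j| ≤ √c * ((γ⁻¹ * frob M + γ * frob L) / 2) := by
  refine (sum_abs_le_sqrt_mul_sqrt _).trans ?_
  refine mul_le_mul_of_nonneg_left ?_ (Real.sqrt_nonneg _)
  have h1 : ∑ j, (M * L) i j ^ 2 ≤ frob M * frob L := by
    calc ∑ j, (M * L) i j ^ 2 ≤ ∑ j, (∑ k, M i k ^ 2) * ∑ k, L k j ^ 2 := by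
          refine Finset.sum_le_sum fun j _ => ?_
          rw [Matrix.mul_apply]
          exact Finset.sum_mul_sq_le_sq_mul_sq _ _ _
      _ = (∑ k, M i k ^ 2) * frob L := by rw [← Finset.mul_sum, frob, Finset.sum_comm]
      _ ≤ frob M * frob L := by
          refine mul_le_mul_of_nonneg_right ?_ (frob_nonneg _)
          exact Finset.single_le_sum (f := fun i => ∑ k, M i k ^ 2)
            (fun _ _ => Finset.sum_nonneg fun _ _ => sq_nonneg _) (Finset.mem_univ i)
  have hM := frob_nonneg M
  have hL := frob_nonneg L
  refine Real.sqrt_le_iff.mpr ⟨by positivity, h1.trans ?_⟩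
  have h2 : frob M * frob L = (γ⁻¹ * frob M) * (γ * frob L) := by field_simp
  rw [h2]
  nlinarith [sq_nonneg (γ⁻¹ * frob M - γ * frob L)]

theorem kernel_eq_half_mul_half (S : StateSpace N m p) (t : ℝ) :
    S.kernel t = (S.C * NormedSpace.exp (t • ((1 / 2 : ℝ) • S.A))) *
      (NormedSpace.exp (t • ((1 / 2 : ℝ) • S.A)) * S.B) := by
  have h : NormedSpace.exp (t • S.A) = NormedSpace.exp (t • ((1 / 2 : ℝ) • S.A)) *
      NormedSpace.exp (t • ((1 / 2 : ℝ) • S.A)) := by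
    rw [← Matrix.exp_add_of_commute _ _ (Commute.refl _)]
    congr 1
    rw [← smul_add, ← add_smul]
    norm_num
  rw [StateSpace.kernel, h]
  simp only [Matrix.mul_assoc]

theorem continuous_kernel (S : StateSpace N m p) : Continuous S.kernel :=
  (continuous_const.matrix_mul (continuous_exp_smul S.A)).matrix_mul continuous_const

/-- The `L¹` norm of a row of the impulse response of an input-normal system. -/
theorem integral_sum_abs_kernel_le (S : StateSpace N m p) (hA : IsHurwitz S.A)
    (hW : S.A + S.Aᵀ = -(S.B * S.Bᵀ)) {γ : ℝ} (hγ0 : 0 < γ)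
    (hγ : ∀ (ω : ℝ) (v : Fin p → ℂ),
      nsq ((toC S.C * cRes S.A (ω * Complex.I) * toC S.B + toC S.D) *ᵥ v) ≤ γ ^ 2 * nsq v)
    (i : Fin m) {T : ℝ} (hT : 0 ≤ T) :
    ∫ t in (0 : ℝ)..T, ∑ j, |S.kernel t i j| ≤ 2 * N * √p * γ := by
  obtain ⟨V, hVs, hV, hnn⟩ := hA.exists_gramian S.C
  have htr : V.trace ≤ N * γ ^ 2 := by
    calc V.trace ≤ ∑ _k : Fin N, γ ^ 2 := by
          refine Finset.sum_le_sum fun k _ => ?_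
          have := gramian_le_of_hinf_le S hA hW hVs hV hγ (Pi.single k 1)
          simpa using this
      _ = _ := by simp
  set g : ℝ → Matrix (Fin N) (Fin N) ℝ := fun t => NormedSpace.exp (t • ((1 / 2 : ℝ) • S.A))
    with hg
  -- Halving the generator doubles the Gramian: `2V` solves the Lyapunov equation of `A/2`. The same
  -- holds below with `2I` for the input side.
  have hα : ∫ t in (0 : ℝ)..T, frob (S.C * g t) ≤ 2 * V.trace := by
    have h1 : ((1 / 2 : ℝ) • S.A)ᵀ * ((2 : ℝ) • V) + ((2 : ℝ) • V) * ((1 / 2 : ℝ) • S.A) =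
        -(S.Cᵀ * S.C) := by
      rw [← hV, Matrix.transpose_smul, Matrix.smul_mul, Matrix.mul_smul, Matrix.smul_mul,
        Matrix.mul_smul, smul_smul, smul_smul]
      norm_num
    refine (integral_frob_le_trace h1 (fun x => ?_) T).trans_eq ?_
    · rw [Matrix.smul_mulVec, dotProduct_smul, smul_eq_mul]
      exact mul_nonneg zero_le_two (hnn x)
    · rw [Matrix.trace_smul, smul_eq_mul]
  have hgB : ∀ t, frob (g t * S.B) =
      frob (S.Bᵀ * NormedSpace.exp (t • ((1 / 2 : ℝ) • S.Aᵀ))) := by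
    intro t
    rw [← frob_transpose, Matrix.transpose_mul, hg, ← Matrix.exp_transpose,
      Matrix.transpose_smul, Matrix.transpose_smul]
  have hβ : ∫ t in (0 : ℝ)..T, frob (g t * S.B) ≤ 2 * N := by
    simp only [hgB]
    have h1 : ((1 / 2 : ℝ) • S.Aᵀ)ᵀ * ((2 : ℝ) • (1 : Matrix (Fin N) (Fin N) ℝ)) +
        ((2 : ℝ) • (1 : Matrix (Fin N) (Fin N) ℝ)) * ((1 / 2 : ℝ) • S.Aᵀ) =
        -(S.Bᵀᵀ * S.Bᵀ) := by
      rw [Matrix.transpose_transpose, ← hW, Matrix.transpose_smul, Matrix.transpose_transpose,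
        Matrix.smul_mul, Matrix.mul_smul, Matrix.smul_mul, Matrix.mul_smul, smul_smul, smul_smul,
        Matrix.mul_one, Matrix.one_mul]
      norm_num
    refine (integral_frob_le_trace h1 (fun x => ?_) T).trans_eq ?_
    · rw [Matrix.smul_mulVec, dotProduct_smul, smul_eq_mul, Matrix.one_mulVec]
      exact mul_nonneg zero_le_two (Finset.sum_nonneg fun _ _ => mul_self_nonneg _)
    · rw [Matrix.trace_smul, smul_eq_mul, Matrix.trace_one, Fintype.card_fin]
  have hcα : Continuous fun t => frob (S.C * g t) := continuous_frob_mul_exp _ _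
  have hcβ : Continuous fun t => frob (g t * S.B) := by
    simp only [hgB]
    exact continuous_frob_mul_exp _ _
  have hck : Continuous fun t => ∑ j, |S.kernel t i j| :=
    continuous_finsetSum _ fun j _ => ((continuous_kernel S).matrix_elem i j).abs
  calc ∫ t in (0 : ℝ)..T, ∑ j, |S.kernel t i j|
      ≤ ∫ t in (0 : ℝ)..T, √p * ((γ⁻¹ * frob (S.C * g t) + γ * frob (g t * S.B)) / 2) := by
        refine intervalIntegral.integral_mono_on hT (hck.intervalIntegrable _ _)
          (Continuous.intervalIntegrable (by fun_prop) _ _) fun t _ => ?_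
        rw [kernel_eq_half_mul_half]
        exact sum_abs_mul_le _ _ i hγ0
    _ = √p * ((γ⁻¹ * (∫ t in (0 : ℝ)..T, frob (S.C * g t))
          + γ * ∫ t in (0 : ℝ)..T, frob (g t * S.B)) / 2) := by
        rw [intervalIntegral.integral_const_mul, intervalIntegral.integral_div,
          intervalIntegral.integral_add ((hcα.const_mul _).intervalIntegrable _ _)
            ((hcβ.const_mul _).intervalIntegrable _ _), intervalIntegral.integral_const_mul,
          intervalIntegral.integral_const_mul]
    _ ≤ √p * ((γ⁻¹ * (2 * (N * γ ^ 2)) + γ * (2 * N)) / 2) := by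
        gcongr
        linarith
    _ = _ := by field_simp; ring

/-- As `ω → ∞` the bound passes to `D`. Testing it on the `i`-th row of `D`, with squared norm `d`,
gives `d² ≤ γ²d`. -/
theorem sum_abs_feedthrough_le (S : StateSpace N m p) (hA : IsHurwitz S.A) {γ : ℝ} (hγ0 : 0 ≤ γ)
    (hγ : ∀ (ω : ℝ) (v : Fin p → ℂ),
      nsq ((toC S.C * cRes S.A (ω * Complex.I) * toC S.B + toC S.D) *ᵥ v) ≤ γ ^ 2 * nsq v)
    (i : Fin m) : ∑ j, |S.D i j| ≤ √p * γ := by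
  set d := ∑ j, S.D i j ^ 2 with hd
  have hd0 : 0 ≤ d := Finset.sum_nonneg fun _ _ => sq_nonneg _
  have hlim : Filter.Tendsto (fun ω : ℝ => cRes S.A (ω * Complex.I)) Filter.atTop (nhds 0) := by
    open scoped Matrix.Norms.L2Operator in
    obtain ⟨M, hM0, hM⟩ := hA.exists_norm_cRes_le
    rw [tendsto_zero_iff_norm_tendsto_zero]
    have h1 : Filter.Tendsto (fun ω : ℝ => M / (1 + |ω|)) Filter.atTop (nhds 0) :=
      Filter.Tendsto.div_atTop tendsto_const_nhds
        (Filter.tendsto_atTop_add_const_left _ _ Filter.tendsto_abs_atTop_atTop)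
    refine squeeze_zero (fun _ => norm_nonneg _) (fun ω => ?_) h1
    simpa using hM (ω * Complex.I) (by simp)
  set v : Fin p → ℂ := cv (S.D i) with hv
  have hcont : Continuous fun R : Matrix (Fin N) (Fin N) ℂ =>
      nsq ((toC S.C * R * toC S.B + toC S.D) *ᵥ v) := by
    unfold nsq
    refine continuous_finsetSum _ fun j _ => ?_
    have : Continuous fun R : Matrix (Fin N) (Fin N) ℂ =>
      (toC S.C * R * toC S.B + toC S.D) *ᵥ v := by fun_prop
    exact ((continuous_apply j).comp this).norm.pow 2
  have h2 := le_of_tendsto' ((hcont.tendsto 0).comp hlim) (fun ω => hγ ω v)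
  rw [Matrix.mul_zero, Matrix.zero_mul, zero_add, hv, ← cv_mulVec] at h2
  have hnv : nsq (cv (S.D i)) = d := by simp [nsq, cv, hd]
  have hDv : d ^ 2 ≤ nsq (cv (S.D *ᵥ S.D i)) := by
    have h3 : ‖cv (S.D *ᵥ S.D i) i‖ ^ 2 = d ^ 2 := by
      have h5 : (S.D *ᵥ S.D i) i = d := by simp [Matrix.mulVec, dotProduct, hd, sq]
      rw [cv, h5, Complex.norm_real, Real.norm_eq_abs, sq_abs]
    rw [← h3]
    exact Finset.single_le_sum (f := fun k => ‖cv (S.D *ᵥ S.D i) k‖ ^ 2)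
      (fun _ _ => sq_nonneg _) (Finset.mem_univ i)
  rw [hnv] at h2
  have h4 : d ≤ γ ^ 2 := by
    by_contra! hlt
    nlinarith [sq_nonneg γ]
  refine (sum_abs_le_sqrt_mul_sqrt _).trans ?_
  refine mul_le_mul_of_nonneg_left ?_ (Real.sqrt_nonneg _)
  exact Real.sqrt_le_iff.mpr ⟨hγ0, h4⟩

end Energy

/-! ### The upper bound on the peak-to-peak gain. -/

section UpperBound

variable {N N' m p : ℕ}

theorem norm_toLp_sq {a : ℕ} (v : Fin a → ℂ) : ‖WithLp.toLp 2 v‖ ^ 2 = nsq v :=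
  EuclideanSpace.norm_sq_eq _

open scoped Matrix.Norms.L2Operator in
theorem nsq_mulVec_le {a b : ℕ} (M : Matrix (Fin a) (Fin b) ℂ) (v : Fin b → ℂ) :
    nsq (M *ᵥ v) ≤ ‖M‖ ^ 2 * nsq v := by
  rw [← norm_toLp_sq, ← norm_toLp_sq, ← mul_pow]
  exact pow_le_pow_left₀ (norm_nonneg _) (M.l2_opNorm_mulVec (WithLp.toLp 2 v)) 2

open scoped Matrix.Norms.L2Operator in
theorem l2_opNorm_le_of_nsq_le {a b : ℕ} (M : Matrix (Fin a) (Fin b) ℂ) {c : ℝ} (hc : 0 ≤ c)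
    (h : ∀ v, nsq (M *ᵥ v) ≤ c ^ 2 * nsq v) : ‖M‖ ≤ c := by
  rw [Matrix.l2_opNorm_def]
  refine ContinuousLinearMap.opNorm_le_bound _ hc fun x => ?_
  have h1 := h x.ofLp
  rw [← norm_toLp_sq, ← norm_toLp_sq, ← mul_pow] at h1
  exact le_of_sq_le_sq h1 (by positivity)

open scoped Matrix.Norms.L2Operator in
theorem hinfNorm_lt_top (S : StateSpace N m p) (hA : IsHurwitz S.A) (hS : IsStable S.transfer) :
    hinfNorm S.transfer < ∞ := by
  obtain ⟨M, hM0, hM⟩ := hA.exists_norm_cRes_le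
  refine lt_of_le_of_lt (iSup_le fun ω => ENNReal.ofReal_le_ofReal
    (q := ‖toC S.C‖ * M * ‖toC S.B‖ + ‖toC S.D‖) ?_) ENNReal.ofReal_lt_top
  rw [evalAt_transfer S hA hS (by simp)]
  refine (norm_add_le _ _).trans (add_le_add ?_ le_rfl)
  refine (Matrix.l2_opNorm_mul _ _).trans ?_
  refine mul_le_mul_of_nonneg_right ((Matrix.l2_opNorm_mul _ _).trans ?_) (norm_nonneg _)
  refine mul_le_mul_of_nonneg_left ((hM _ (by simp)).trans ?_) (norm_nonneg _)
  exact div_le_self hM0 (by linarith [norm_nonneg ((ω : ℂ) * Complex.I)])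

open scoped Matrix.Norms.L2Operator in
theorem nsq_mulVec_le_of_hinfNorm_le (S : StateSpace N m p) (hA : IsHurwitz S.A)
    (hS : IsStable S.transfer) {γ : ℝ} (hγ0 : 0 ≤ γ)
    (hγ : hinfNorm S.transfer ≤ ENNReal.ofReal γ) (ω : ℝ) (v : Fin p → ℂ) :
    nsq ((toC S.C * cRes S.A (ω * Complex.I) * toC S.B + toC S.D) *ᵥ v) ≤ γ ^ 2 * nsq v := by
  rw [← evalAt_transfer S hA hS (by simp)]
  refine (nsq_mulVec_le _ _).trans (mul_le_mul_of_nonneg_right ?_ (nsq_nonneg _))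
  refine pow_le_pow_left₀ (norm_nonneg _) ?_ 2
  exact (ENNReal.ofReal_le_ofReal_iff hγ0).mp
    ((le_iSup (fun ω : ℝ => ENNReal.ofReal ‖evalAt S.transfer (ω * Complex.I)‖) ω).trans hγ)

theorem abs_mulVec_apply_le (M : Matrix (Fin m) (Fin p) ℝ) (x : Fin p → ℝ) {c : ℝ}
    (hx : ‖x‖ ≤ c) (i : Fin m) : |(M *ᵥ x) i| ≤ (∑ j, |M i j|) * c := by
  rw [Matrix.mulVec, dotProduct, Finset.sum_mul]
  refine (Finset.abs_sum_le_sum_abs _ _).trans (Finset.sum_le_sum fun j _ => ?_)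
  rw [abs_mul]
  exact mul_le_mul_of_nonneg_left ((norm_le_pi_norm x j).trans hx) (abs_nonneg _)

theorem intervalIntegrable_kernel_mulVec (S : StateSpace N m p) {u : ℝ → Fin p → ℝ}
    (hu : MemLp u ∞ (volume.restrict (Set.Ici (0 : ℝ)))) {t : ℝ} (ht : 0 ≤ t) (i : Fin m) :
    IntervalIntegrable (fun τ => ((S.kernel (t - τ)) *ᵥ (u τ)) i) volume 0 t := by
  have huj : ∀ j, IntervalIntegrable (fun τ => u τ j) volume 0 t := by
    intro j
    rw [intervalIntegrable_iff_integrableOn_Ioc_of_le ht]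
    have h1 : MemLp u ∞ (volume.restrict (Set.Ioc 0 t)) :=
      hu.mono_measure (Measure.restrict_mono (fun x hx => hx.1.le) le_rfl)
    exact (h1.integrable le_top).eval j
  have hK : ∀ j, Continuous fun τ => S.kernel (t - τ) i j := fun j =>
    ((continuous_kernel S).comp (continuous_const.sub continuous_id)).matrix_elem i j
  simp only [Matrix.mulVec, dotProduct]
  have := IntervalIntegrable.sum Finset.univ
    (f := fun j τ => S.kernel (t - τ) i j * u τ j)
    fun j _ => (huj j).continuousOn_mul (hK j).continuousOn
  exact this.congr (fun τ _ => by simp)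

theorem response_apply (S : StateSpace N m p) {u : ℝ → Fin p → ℝ} {t : ℝ} (ht : 0 ≤ t)
    (hu : ∀ i, IntervalIntegrable (fun τ => ((S.kernel (t - τ)) *ᵥ (u τ)) i) volume 0 t)
    (i : Fin m) : S.response u t i =
      (∫ τ in (0 : ℝ)..t, ((S.kernel (t - τ)) *ᵥ (u τ)) i) + (S.D *ᵥ u t) i := by
  rw [StateSpace.response, Pi.add_apply, intervalIntegral.integral_of_le ht,
    intervalIntegral.integral_of_le ht, eval_integral]
  intro i
  have := hu i
  rwa [intervalIntegrable_iff_integrableOn_Ioc_of_le ht] at this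

theorem signalNorm_response_le (S : StateSpace N m p) {L d : ℝ}
    (hL : ∀ (i : Fin m) (T : ℝ), 0 ≤ T → ∫ t in (0 : ℝ)..T, ∑ j, |S.kernel t i j| ≤ L)
    (hd : ∀ i, ∑ j, |S.D i j| ≤ d) (hL0 : 0 ≤ L) (hd0 : 0 ≤ d) {u : ℝ → Fin p → ℝ}
    (hu : MemLp u ∞ (volume.restrict (Set.Ici (0 : ℝ)))) :
    signalNorm (S.response u) ≤ ENNReal.ofReal (L + d) * signalNorm u := by
  set M := (signalNorm u).toReal with hM
  have hfin : signalNorm u ≠ ∞ := hu.eLpNorm_ne_top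
  have hM0 : 0 ≤ M := ENNReal.toReal_nonneg
  have hae : ∀ᵐ t ∂(volume.restrict (Set.Ici (0 : ℝ))), ‖u t‖ ≤ M := by
    filter_upwards [ae_le_eLpNormEssSup (f := u) (μ := volume.restrict (Set.Ici (0 : ℝ)))] with t ht
    rw [← eLpNorm_exponent_top] at ht
    rw [← toReal_enorm]
    exact ENNReal.toReal_mono hfin ht
  have hbound : ∀ᵐ t ∂(volume.restrict (Set.Ici (0 : ℝ))), ‖S.response u t‖ ≤ (L + d) * M := by
    filter_upwards [hae, ae_restrict_mem measurableSet_Ici] with t htM ht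
    have ht0 : (0 : ℝ) ≤ t := ht
    rw [pi_norm_le_iff_of_nonneg (by positivity)]
    intro i
    rw [response_apply S ht0 (intervalIntegrable_kernel_mulVec S hu ht0), add_mul]
    refine (norm_add_le _ _).trans (add_le_add ?_ ?_)
    · have hcK : Continuous fun t => ∑ j, |S.kernel t i j| :=
        continuous_finsetSum _ fun j _ => ((continuous_kernel S).matrix_elem i j).abs
      have h1 := intervalIntegral.norm_integral_le_of_norm_le (μ := volume)
        (f := fun τ => ((S.kernel (t - τ)) *ᵥ (u τ)) i)
        (g := fun τ => (∑ j, |S.kernel (t - τ) i j|) * M) ht0 (by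
          rw [ae_restrict_iff' measurableSet_Ici] at hae
          filter_upwards [hae] with τ hτ hmem
          exact abs_mulVec_apply_le _ _ (hτ hmem.1.le) i)
        (((hcK.comp (continuous_const.sub continuous_id)).mul_const M).intervalIntegrable _ _)
      refine h1.trans ?_
      rw [intervalIntegral.integral_mul_const,
        intervalIntegral.integral_comp_sub_left (fun t => ∑ j, |S.kernel t i j|), sub_self,
        sub_zero]
      exact mul_le_mul_of_nonneg_right (hL i t ht0) hM0
    · exact (abs_mulVec_apply_le _ _ htM i).trans (mul_le_mul_of_nonneg_right (hd i) hM0)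
  rw [signalNorm, eLpNorm_exponent_top]
  refine (eLpNormEssSup_le_of_ae_bound hbound).trans ?_
  rw [ENNReal.ofReal_mul (by positivity), hM, ENNReal.ofReal_toReal hfin]

/-- Peak-to-peak bound in terms of an input-normal realization. -/
theorem signalNorm_le_mul_hinfNorm (S : StateSpace N m p) (S' : StateSpace N' m p)
    (hS : IsStable S.transfer) (hS' : S'.transfer = S.transfer) (hA : IsHurwitz S'.A)
    (hW : S'.A + S'.Aᵀ = -(S'.B * S'.Bᵀ)) {u : ℝ → Fin p → ℝ}
    (hu : MemLp u ∞ (volume.restrict (Set.Ici (0 : ℝ)))) :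
    signalNorm (S.response u) ≤
      (2 * N' + 1) * (p : ℝ≥0∞) ^ (1 / 2 : ℝ) * hinfNorm S.transfer * signalNorm u := by
  have hSt' : IsStable S'.transfer := hS' ▸ hS
  have hfin := hinfNorm_lt_top S' hA hSt'
  rw [response_eq_of_transfer_eq S S' hS'.symm, ← hS']
  set h := (hinfNorm S'.transfer).toReal with hh
  have hh0 : 0 ≤ h := ENNReal.toReal_nonneg
  -- The weight `γ⁻¹` needs `γ > 0`, and the norm `h` may vanish; hence strict bounds first and a
  -- limit afterwards.
  have key : ∀ γ : ℝ, h < γ → signalNorm (S'.response u) ≤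
      ENNReal.ofReal ((2 * N' + 1) * √p * γ) * signalNorm u := by
    intro γ hγ
    have hγ0 : 0 < γ := lt_of_le_of_lt hh0 hγ
    have hle : hinfNorm S'.transfer ≤ ENNReal.ofReal γ := by
      rw [← ENNReal.ofReal_toReal hfin.ne]
      exact ENNReal.ofReal_le_ofReal hγ.le
    have hb := nsq_mulVec_le_of_hinfNorm_le S' hA hSt' hγ0.le hle
    have := signalNorm_response_le S' (L := 2 * N' * √p * γ) (d := √p * γ)
      (fun i T hT => integral_sum_abs_kernel_le S' hA hW hγ0 hb i hT)
      (fun i => sum_abs_feedthrough_le S' hA hγ0.le hb i) (by positivity) (by positivity) hu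
    refine this.trans_eq ?_
    congr 2
    ring
  have hlim : Filter.Tendsto (fun γ : ℝ => ENNReal.ofReal ((2 * N' + 1) * √p * γ) * signalNorm u)
      (nhdsWithin h (Set.Ioi h))
      (nhds (ENNReal.ofReal ((2 * N' + 1) * √p * h) * signalNorm u)) := by
    refine ENNReal.Tendsto.mul_const ?_ (Or.inr hu.eLpNorm_ne_top)
    refine ENNReal.tendsto_ofReal ?_
    exact ((continuous_const.mul continuous_id).tendsto h).mono_left nhdsWithin_le_nhds
  refine (ge_of_tendsto hlim (by
    filter_upwards [self_mem_nhdsWithin] with γ hγ using key γ hγ)).trans_eq ?_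
  congr 1
  rw [ENNReal.ofReal_mul (by positivity), ENNReal.ofReal_mul (by positivity), hh,
    ENNReal.ofReal_toReal hfin.ne, Real.sqrt_eq_rpow,
    ← ENNReal.ofReal_rpow_of_nonneg (Nat.cast_nonneg p) (by norm_num), ENNReal.ofReal_natCast]
  congr 2
  rw [ENNReal.ofReal_add (by positivity) zero_le_one, ENNReal.ofReal_mul zero_le_two]
  simp

theorem peakGain_le (G : Matrix (Fin m) (Fin p) (RatFunc ℝ)) (hG : IsStable G) :
    peakGain G ≤
      (2 * mcmillanDegree G + 1) * (p : ℝ≥0∞) ^ (1 / 2 : ℝ) * hinfNorm G := by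
  refine iSup_le fun u => iSup_le fun y => iSup_le fun hu => iSup_le fun hu0 => iSup_le fun hy => ?_
  obtain ⟨N, S, rfl, rfl⟩ := hy
  obtain ⟨S₀, hS₀⟩ : mcmillanDegree S.transfer ∈
      {N : ℕ | ∃ S' : StateSpace N m p, S'.transfer = S.transfer} := Nat.sInf_mem ⟨N, S, rfl⟩
  obtain ⟨r, S', hr, ht, hA, hW⟩ := exists_inputNormal_realization S₀ (hS₀.symm ▸ hG)
  have h := signalNorm_le_mul_hinfNorm S S' hG (ht.trans hS₀) hA hW hu
  refine (ENNReal.div_le_of_le_mul h).trans ?_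
  gcongr

end UpperBound

/-! ### The lower bound by harmonic inputs. -/

section LowerBound

variable {N m p : ℕ}

open scoped Matrix.Norms.L2Operator in
theorem hasDerivAt_mul_exp_sub_apply (C : Matrix (Fin m) (Fin N) ℝ) (A : Matrix (Fin N) (Fin N) ℝ)
    (t τ : ℝ) (i : Fin m) (k : Fin N) :
    HasDerivAt (fun τ : ℝ => (C * NormedSpace.exp ((t - τ) • A)) i k)
      (-(C * NormedSpace.exp ((t - τ) • A) * A) i k) τ := by
  let l : Matrix (Fin N) (Fin N) ℝ →ₗ[ℝ] ℝ :=
    { toFun := fun M => (C * M) i k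
      map_add' := fun M M' => by rw [Matrix.mul_add, Matrix.add_apply]
      map_smul' := fun c M => by rw [Matrix.mul_smul, Matrix.smul_apply]; rfl }
  have h1 := hasDerivAt_exp_smul_const (𝕂 := ℝ) A (t - τ)
  have h2 := (LinearMap.toContinuousLinearMap l).hasFDerivAt.comp_hasDerivAt (t - τ) h1
  have h3 : HasDerivAt (fun s : ℝ => (C * NormedSpace.exp (s • A)) i k)
      ((C * (NormedSpace.exp ((t - τ) • A) * A)) i k) (t - τ) := h2
  have h4 := h3.comp_const_sub t τ
  rwa [← Matrix.mul_assoc] at h4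

/-- Variation of constants: the response in terms of a particular solution. -/
theorem response_eq_of_hasDerivAt (S : StateSpace N m p) {u : ℝ → Fin p → ℝ} {ξ : ℝ → Fin N → ℝ}
    (hu : Continuous u)
    (hξ : ∀ τ k, HasDerivAt (fun τ => ξ τ k) ((S.A *ᵥ ξ τ + S.B *ᵥ u τ) k) τ) {t : ℝ} (ht : 0 ≤ t) :
    S.response u t =
      S.C *ᵥ ξ t - (S.C * NormedSpace.exp (t • S.A)) *ᵥ ξ 0 + S.D *ᵥ u t := by
  have hcont : ∀ i, Continuous fun τ => ((S.kernel (t - τ)) *ᵥ (u τ)) i := fun i =>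
    (continuous_apply i).comp
      (((continuous_kernel S).comp (continuous_const.sub continuous_id)).matrix_mulVec hu)
  ext i
  rw [response_apply S ht fun i => (hcont i).intervalIntegrable _ _]
  rw [Pi.add_apply, Pi.sub_apply]
  congr 1
  have hderiv : ∀ τ, HasDerivAt
      (fun τ => ((S.C * NormedSpace.exp ((t - τ) • S.A)) *ᵥ ξ τ) i)
      (((S.kernel (t - τ)) *ᵥ (u τ)) i) τ := by
    intro τ
    have h1 := HasDerivAt.fun_sum (u := Finset.univ) fun k (_ : k ∈ Finset.univ) =>
      (hasDerivAt_mul_exp_sub_apply S.C S.A t τ i k).mul (hξ τ k)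
    refine h1.congr_deriv ?_
    set E := NormedSpace.exp ((t - τ) • S.A)
    have h2 : (S.kernel (t - τ)) *ᵥ (u τ) =
        -((S.C * E * S.A) *ᵥ ξ τ) + (S.C * E) *ᵥ (S.A *ᵥ ξ τ + S.B *ᵥ u τ) := by
      rw [Matrix.mulVec_add, Matrix.mulVec_mulVec, Matrix.mulVec_mulVec]
      simp [StateSpace.kernel, E]
    rw [h2, Finset.sum_add_distrib, Pi.add_apply, Pi.neg_apply]
    simp only [neg_mul, Finset.sum_neg_distrib]
    rfl
  rw [intervalIntegral.integral_eq_sub_of_hasDerivAt (fun τ _ => hderiv τ)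
    ((hcont i).intervalIntegrable _ _)]
  simp [NormedSpace.exp_zero]

theorem frob_mul_le {a b c : ℕ} (M : Matrix (Fin a) (Fin b) ℝ) (L : Matrix (Fin b) (Fin c) ℝ) :
    frob (M * L) ≤ frob M * frob L := by
  calc frob (M * L) ≤ ∑ i, ∑ j, (∑ k, M i k ^ 2) * ∑ k, L k j ^ 2 := by
        refine Finset.sum_le_sum fun i _ => Finset.sum_le_sum fun j _ => ?_
        rw [Matrix.mul_apply]
        exact Finset.sum_mul_sq_le_sq_mul_sq _ _ _
    _ = frob M * frob L := by
        rw [frob, frob, Finset.sum_mul, Finset.sum_comm (γ := Fin b)]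
        simp only [Finset.mul_sum]

theorem sq_mulVec_apply_le {a b : ℕ} (M : Matrix (Fin a) (Fin b) ℝ) (x : Fin b → ℝ) (i : Fin a) :
    (M *ᵥ x) i ^ 2 ≤ frob M * ∑ k, x k ^ 2 := by
  rw [Matrix.mulVec, dotProduct]
  refine (Finset.sum_mul_sq_le_sq_mul_sq _ _ _).trans ?_
  refine mul_le_mul_of_nonneg_right ?_ (Finset.sum_nonneg fun _ _ => sq_nonneg _)
  exact Finset.single_le_sum (f := fun i => ∑ k, M i k ^ 2)
    (fun _ _ => Finset.sum_nonneg fun _ _ => sq_nonneg _) (Finset.mem_univ i)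

/-- The real harmonic signal `τ ↦ Re (v e^{jω(τ - T)})`. -/
noncomputable def harmonic {a : ℕ} (ω T : ℝ) (v : Fin a → ℂ) (τ : ℝ) : Fin a → ℝ :=
  fun k => (v k * Complex.exp ((ω * Complex.I) * (τ - T))).re

theorem continuous_harmonic {a : ℕ} (ω T : ℝ) (v : Fin a → ℂ) : Continuous (harmonic ω T v) := by
  unfold harmonic
  fun_prop

theorem harmonic_self {a : ℕ} (ω T : ℝ) (v : Fin a → ℂ) (k : Fin a) :
    harmonic ω T v T k = (v k).re := by
  simp [harmonic]

theorem norm_exp_harmonic (ω T τ : ℝ) : ‖Complex.exp ((ω * Complex.I) * (τ - T))‖ = 1 := by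
  have : ((ω : ℂ) * Complex.I) * (τ - T) = ((ω * (τ - T) : ℝ) : ℂ) * Complex.I := by
    push_cast
    ring
  rw [this, Complex.norm_exp_ofReal_mul_I]

theorem abs_harmonic_le {a : ℕ} (ω T : ℝ) (v : Fin a → ℂ) (τ : ℝ) (k : Fin a) :
    |harmonic ω T v τ k| ≤ ‖v k‖ := by
  refine (Complex.abs_re_le_norm _).trans ?_
  rw [norm_mul, norm_exp_harmonic, mul_one]

theorem harmonic_mulVec {a b : ℕ} (ω T : ℝ) (M : Matrix (Fin a) (Fin b) ℝ) (v : Fin b → ℂ)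
    (τ : ℝ) : harmonic ω T (toC M *ᵥ v) τ = M *ᵥ harmonic ω T v τ := by
  ext i
  simp only [harmonic, Matrix.mulVec, dotProduct, toC, Matrix.map_apply, Finset.sum_mul,
    Complex.re_sum]
  refine Finset.sum_congr rfl fun k _ => ?_
  rw [mul_assoc, Complex.re_ofReal_mul]

theorem harmonic_add {a : ℕ} (ω T : ℝ) (v w : Fin a → ℂ) (τ : ℝ) :
    harmonic ω T (v + w) τ = harmonic ω T v τ + harmonic ω T w τ := by
  ext i
  simp [harmonic, add_mul]

theorem hasDerivAt_harmonic {a : ℕ} (ω T : ℝ) (v : Fin a → ℂ) (τ : ℝ) (k : Fin a) :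
    HasDerivAt (fun τ => harmonic ω T v τ k)
      (harmonic ω T (fun k => (ω * Complex.I) * v k) τ k) τ := by
  have h1 : HasDerivAt (fun s : ℂ => v k * Complex.exp ((ω * Complex.I) * (s - T)))
      ((ω * Complex.I) * v k * Complex.exp ((ω * Complex.I) * (τ - T))) (τ : ℂ) := by
    have h2 : HasDerivAt (fun s : ℂ => (ω * Complex.I) * (s - T)) (ω * Complex.I) (τ : ℂ) := by
      simpa using ((hasDerivAt_id (τ : ℂ)).sub_const (T : ℂ)).const_mul (ω * Complex.I)
    refine (h2.cexp.const_mul (v k)).congr_deriv ?_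
    ring
  exact h1.real_of_complex

/-- By continuity a violation at `T > 0` would persist on an open subset of the positive axis, which
has positive measure. -/
theorem norm_le_of_signalNorm_le {y : ℝ → Fin m → ℝ} {z : ℝ → Fin m → ℝ} (hz : Continuous z)
    (hyz : ∀ t, 0 ≤ t → y t = z t) {c : ℝ} (hc : 0 ≤ c) (h : signalNorm y ≤ ENNReal.ofReal c)
    {T : ℝ} (hT : 0 < T) : ‖y T‖ ≤ c := by
  have hae : ∀ᵐ t ∂(volume.restrict (Set.Ici (0 : ℝ))), ‖y t‖ ≤ c := by
    filter_upwards [ae_le_eLpNormEssSup (f := y) (μ := volume.restrict (Set.Ici (0 : ℝ)))] with t ht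
    rw [← eLpNorm_exponent_top] at ht
    have := ht.trans h
    rw [← ofReal_norm] at this
    exact (ENNReal.ofReal_le_ofReal_iff hc).mp this
  rw [ae_restrict_iff' measurableSet_Ici] at hae
  by_contra! hlt
  rw [hyz T hT.le] at hlt
  have hopen : IsOpen ({t | c < ‖z t‖} ∩ Set.Ioi 0) :=
    (isOpen_lt continuous_const hz.norm).inter isOpen_Ioi
  have hpos := hopen.measure_pos volume ⟨T, hlt, hT⟩
  refine hpos.ne' (measure_mono_null ?_ hae)
  rintro t ⟨h1, h2⟩ hcon
  have ht : (0 : ℝ) ≤ t := le_of_lt h2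
  have := hcon ht
  rw [hyz t ht] at this
  exact absurd this (not_le.mpr h1)

theorem signalNorm_response_le_peakGain (S : StateSpace N m p) (hS : IsStable S.transfer)
    {u : ℝ → Fin p → ℝ} (hu : MemLp u ∞ (volume.restrict (Set.Ici (0 : ℝ)))) :
    signalNorm (S.response u) ≤ peakGain S.transfer * signalNorm u := by
  by_cases h0 : signalNorm u = 0
  -- Inputs of norm zero lie outside the supremum; the upper bound shows that their response has
  -- norm zero too.
  · obtain ⟨r, S', -, ht, hA, hW⟩ := exists_inputNormal_realization S hS
    have := signalNorm_le_mul_hinfNorm S S' hS ht hA hW hu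
    rw [h0, mul_zero] at this
    exact this.trans zero_le
  · rw [← ENNReal.div_le_iff h0 hu.eLpNorm_ne_top]
    exact le_iSup_of_le u (le_iSup_of_le (S.response u) (le_iSup_of_le hu (le_iSup_of_le h0
      (le_iSup_of_le ⟨N, S, rfl, rfl⟩ le_rfl))))

theorem norm_apply_sq_le_nsq {a : ℕ} (v : Fin a → ℂ) (k : Fin a) : ‖v k‖ ^ 2 ≤ nsq v :=
  Finset.single_le_sum (f := fun k => ‖v k‖ ^ 2) (fun _ _ => sq_nonneg _) (Finset.mem_univ k)

/-- Harmonic inputs bound each output of the frequency response by the peak-to-peak gain. -/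
theorem re_evalAt_mulVec_le (S : StateSpace N m p) (hA : IsHurwitz S.A)
    (hS : IsStable S.transfer) (hfin : peakGain S.transfer ≠ ∞) (ω : ℝ) (v : Fin p → ℂ)
    (i : Fin m) :
    ((evalAt S.transfer (ω * Complex.I) *ᵥ v) i).re ≤
      (peakGain S.transfer).toReal * √(nsq v) := by
  set g := (peakGain S.transfer).toReal with hg
  have hg0 : 0 ≤ g := ENNReal.toReal_nonneg
  set x : Fin N → ℂ := cRes S.A (ω * Complex.I) *ᵥ (toC S.B *ᵥ v) with hx
  have hs : (0 : ℝ) ≤ ((ω : ℂ) * Complex.I).re := by simp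
  have hxeq : (fun k => (ω * Complex.I) * x k) = toC S.A *ᵥ x + toC S.B *ᵥ v := by
    have h1 : (algebraMap ℂ (Matrix (Fin N) (Fin N) ℂ) (ω * Complex.I) - toC S.A) *ᵥ x =
        toC S.B *ᵥ v := by
      rw [hx, Matrix.mulVec_mulVec, hA.sub_mul_cRes hs, Matrix.one_mulVec]
    rw [← h1, Matrix.sub_mulVec, Algebra.algebraMap_eq_smul_one, Matrix.smul_mulVec,
      Matrix.one_mulVec, add_sub_cancel]
    rfl
  have hw : evalAt S.transfer (ω * Complex.I) *ᵥ v = toC S.C *ᵥ x + toC S.D *ᵥ v := by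
    rw [evalAt_transfer S hA hS hs, Matrix.add_mulVec, hx, Matrix.mulVec_mulVec,
      Matrix.mulVec_mulVec, Matrix.mul_assoc]
  refine le_of_forall_pos_le_add fun ε hε => ?_
  -- The summand 1 only keeps `c` positive; `T` is then taken so large that the transient `C e^{AT}
  -- ξ(0)` is at most `ε`.
  set c := frob S.C * nsq x + 1 with hc
  have hc0 : 0 < c := by
    have := mul_nonneg (frob_nonneg S.C) (nsq_nonneg x)
    linarith
  obtain ⟨T, hT, hTε⟩ := hA.exists_frob_exp_lt (ε := ε ^ 2 / c) (by positivity)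
  set u := harmonic ω T v with hu
  set ξ := harmonic ω T x with hξ
  have hub : ∀ τ, ‖u τ‖ ≤ √(nsq v) := fun τ => by
    rw [pi_norm_le_iff_of_nonneg (Real.sqrt_nonneg _)]
    exact fun k => (abs_harmonic_le ω T v τ k).trans
      (Real.le_sqrt_of_sq_le (norm_apply_sq_le_nsq v k))
  have huc : Continuous u := continuous_harmonic ω T v
  have humem : MemLp u ∞ (volume.restrict (Set.Ici (0 : ℝ))) :=
    memLp_top_of_bound huc.aestronglyMeasurable _ (Filter.Eventually.of_forall hub)
  have hunorm : signalNorm u ≤ ENNReal.ofReal √(nsq v) := by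
    rw [signalNorm, eLpNorm_exponent_top]
    exact eLpNormEssSup_le_of_ae_bound (Filter.Eventually.of_forall hub)
  have hy : ∀ t, 0 ≤ t → S.response u t =
      S.C *ᵥ ξ t - (S.C * NormedSpace.exp (t • S.A)) *ᵥ ξ 0 + S.D *ᵥ u t := fun t ht => by
    refine response_eq_of_hasDerivAt S huc (fun τ k => ?_) ht
    have := hasDerivAt_harmonic ω T x τ k
    rwa [hxeq, harmonic_add, harmonic_mulVec, harmonic_mulVec] at this
  have hyc : Continuous fun t : ℝ =>
      S.C *ᵥ ξ t - (S.C * NormedSpace.exp (t • S.A)) *ᵥ ξ 0 + S.D *ᵥ u t := by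
    have h1 : Continuous ξ := continuous_harmonic ω T x
    have h2 := continuous_exp_smul S.A
    exact ((continuous_const.matrix_mulVec h1).sub
      ((continuous_const.matrix_mul h2).matrix_mulVec continuous_const)).add
      (continuous_const.matrix_mulVec huc)
  have hynorm : signalNorm (S.response u) ≤ ENNReal.ofReal (g * √(nsq v)) := by
    refine (signalNorm_response_le_peakGain S hS humem).trans ?_
    rw [ENNReal.ofReal_mul hg0, hg, ENNReal.ofReal_toReal hfin]
    exact mul_le_mul_right hunorm _
  have hyT := norm_le_of_signalNorm_le hyc hy (by positivity) hynorm hT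
  have hyTi := (le_abs_self _).trans ((norm_le_pi_norm (S.response u T) i).trans hyT)
  have hmain : S.response u T i = ((evalAt S.transfer (ω * Complex.I) *ᵥ v) i).re -
      ((S.C * NormedSpace.exp (T • S.A)) *ᵥ ξ 0) i := by
    rw [hy T hT.le, hw, ← harmonic_self ω T, harmonic_add, harmonic_mulVec, harmonic_mulVec]
    simp only [Pi.add_apply, Pi.sub_apply, hξ, hu]
    ring
  have hsmall : ((S.C * NormedSpace.exp (T • S.A)) *ᵥ ξ 0) i ≤ ε := by
    refine le_of_sq_le_sq ?_ hε.le
    refine (sq_mulVec_apply_le _ _ i).trans ?_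
    have h1 : ∑ k, ξ 0 k ^ 2 ≤ nsq x := by
      refine Finset.sum_le_sum fun k _ => ?_
      rw [← sq_abs]
      exact pow_le_pow_left₀ (abs_nonneg _) (abs_harmonic_le ω T x 0 k) 2
    calc frob (S.C * NormedSpace.exp (T • S.A)) * ∑ k, ξ 0 k ^ 2
        ≤ (frob S.C * (ε ^ 2 / c)) * nsq x := by
          refine mul_le_mul ((frob_mul_le _ _).trans ?_) h1
            (Finset.sum_nonneg fun _ _ => sq_nonneg _)
            (mul_nonneg (frob_nonneg _) (by positivity))
          exact mul_le_mul_of_nonneg_left hTε.le (frob_nonneg _)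
      _ = (frob S.C * nsq x) / c * ε ^ 2 := by ring
      _ ≤ 1 * ε ^ 2 := by
          refine mul_le_mul_of_nonneg_right ?_ (sq_nonneg _)
          rw [div_le_one hc0]
          linarith
      _ = ε ^ 2 := one_mul _
  rw [hmain] at hyTi
  linarith

/-- Rotating `v` by a unit phase makes the chosen entry real and nonnegative without changing the
norm of `v`. -/
theorem norm_evalAt_mulVec_le (S : StateSpace N m p) (hA : IsHurwitz S.A)
    (hS : IsStable S.transfer) (hfin : peakGain S.transfer ≠ ∞) (ω : ℝ) (v : Fin p → ℂ)
    (i : Fin m) :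
    ‖(evalAt S.transfer (ω * Complex.I) *ᵥ v) i‖ ≤ (peakGain S.transfer).toReal * √(nsq v) := by
  set w := (evalAt S.transfer (ω * Complex.I) *ᵥ v) i with hw
  by_cases hw0 : w = 0
  · rw [hw0, norm_zero]
    exact mul_nonneg ENNReal.toReal_nonneg (Real.sqrt_nonneg _)
  · have hn : (‖w‖ : ℂ) ≠ 0 := by simpa using hw0
    set a : ℂ := (starRingEnd ℂ) w / ‖w‖ with ha
    have hna : ‖a‖ = 1 := by
      rw [ha, norm_div, RCLike.norm_conj, Complex.norm_real, norm_norm,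
        div_self (by simpa using hw0)]
    have haw : a * w = (‖w‖ : ℂ) := by
      rw [ha, div_mul_eq_mul_div, Complex.conj_mul', sq, mul_div_assoc, div_self hn, mul_one]
    have h1 := re_evalAt_mulVec_le S hA hS hfin ω (a • v) i
    have hnsq : nsq (a • v) = nsq v := by
      simp [nsq, hna]
    rw [Matrix.mulVec_smul, Pi.smul_apply, smul_eq_mul, ← hw, haw, Complex.ofReal_re, hnsq] at h1
    exact h1

open scoped Matrix.Norms.L2Operator in
theorem hinfNorm_le_sqrt_mul_peakGain (S : StateSpace N m p) (hA : IsHurwitz S.A)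
    (hS : IsStable S.transfer) (hfin : peakGain S.transfer ≠ ∞) :
    hinfNorm S.transfer ≤ (m : ℝ≥0∞) ^ (1 / 2 : ℝ) * peakGain S.transfer := by
  set g := (peakGain S.transfer).toReal with hg
  have hg0 : 0 ≤ g := ENNReal.toReal_nonneg
  refine iSup_le fun ω => ?_
  have h1 : ‖evalAt S.transfer (ω * Complex.I)‖ ≤ √m * g := by
    refine l2_opNorm_le_of_nsq_le _ (by positivity) fun v => ?_
    calc nsq (evalAt S.transfer (ω * Complex.I) *ᵥ v)
        ≤ ∑ _i : Fin m, g ^ 2 * nsq v := by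
          refine Finset.sum_le_sum fun i _ => ?_
          have h2 := pow_le_pow_left₀ (norm_nonneg _)
            (norm_evalAt_mulVec_le S hA hS hfin ω v i) 2
          rwa [mul_pow, Real.sq_sqrt (nsq_nonneg v)] at h2
      _ = (√m * g) ^ 2 * nsq v := by
          rw [mul_pow, Real.sq_sqrt (Nat.cast_nonneg m)]
          simp
          ring
  refine (ENNReal.ofReal_le_ofReal h1).trans_eq ?_
  rw [ENNReal.ofReal_mul (Real.sqrt_nonneg _), hg, ENNReal.ofReal_toReal hfin, Real.sqrt_eq_rpow,
    ← ENNReal.ofReal_rpow_of_nonneg (Nat.cast_nonneg m) (by norm_num), ENNReal.ofReal_natCast]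

theorem rpow_neg_half_mul_hinfNorm_le (S : StateSpace N m p) (hA : IsHurwitz S.A)
    (hS : IsStable S.transfer) (hfin : peakGain S.transfer ≠ ∞) :
    (m : ℝ≥0∞) ^ (-(1 / 2) : ℝ) * hinfNorm S.transfer ≤ peakGain S.transfer := by
  have h := hinfNorm_le_sqrt_mul_peakGain S hA hS hfin
  -- For `m = 0` the factor `m^{-1/2}` is infinite, so the norm must be shown to vanish.
  rcases Nat.eq_zero_or_pos m with hm | hm
  · have h0 : hinfNorm S.transfer = 0 := by
      have hz : (m : ℝ≥0∞) ^ (1 / 2 : ℝ) = 0 := by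
        rw [hm, Nat.cast_zero]
        exact ENNReal.zero_rpow_of_pos (by norm_num)
      rw [hz, zero_mul] at h
      exact le_antisymm h zero_le
    rw [h0, mul_zero]
    exact zero_le
  · refine (mul_le_mul_right h _).trans_eq ?_
    rw [← mul_assoc, ← ENNReal.rpow_add _ _ (by exact_mod_cast hm.ne') (ENNReal.natCast_ne_top m),
      neg_add_cancel, ENNReal.rpow_zero, one_mul]

end LowerBound

end LTI

theorem theorem4p2 (n m p : ℕ) (G : Matrix (Fin m) (Fin p) (RatFunc ℝ))
    (hG : LTI.IsStable G) (hn : LTI.mcmillanDegree G = n) :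
    LTI.hinfNorm G < ∞ ∧
    (m : ℝ≥0∞) ^ (-(1 / 2) : ℝ) * LTI.hinfNorm G ≤ LTI.peakGain G ∧
    LTI.peakGain G ≤ (2 * n + 1) * (p : ℝ≥0∞) ^ (1 / 2 : ℝ) * LTI.hinfNorm G := by
  obtain ⟨N, S, rfl⟩ := LTI.exists_realization G fun i j => (hG i j).1
  obtain ⟨r, S', -, ht, hA, -⟩ := LTI.exists_inputNormal_realization S hG
  have hfin : LTI.hinfNorm S.transfer < ∞ := by
    have := LTI.hinfNorm_lt_top S' hA (ht ▸ hG)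
    rwa [ht] at this
  have hup := LTI.peakGain_le S.transfer hG
  rw [hn] at hup
  refine ⟨hfin, ?_, hup⟩
  have hpk : LTI.peakGain S.transfer ≠ ∞ := by
    refine ne_top_of_le_ne_top ?_ hup
    refine ENNReal.mul_ne_top (ENNReal.mul_ne_top ?_ ?_) hfin.ne
    · exact_mod_cast ENNReal.natCast_ne_top (2 * n + 1)
    · exact ENNReal.rpow_ne_top_of_nonneg (by norm_num) (ENNReal.natCast_ne_top p)
  rw [← ht] at hpk hG ⊢
  exact LTI.rpow_neg_half_mul_hinfNorm_le S' hA hG hpk
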